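/- Let $\mathbb{F}=\mathbb{Q}(q,t)$ and let $\Lambda_{\mathbb{F}}$ be the ring of symmetric functions over $\mathbb{F}$ in countably many variables, with monomial symmetric functions $m_\lambda$, power sums $p_\lambda$, and the $q,t$-Hall scalar product, the $\mathbb{F}$-bilinear form with $$\langle p_\lambda,p_\mu\rangle=\delta_{\lambda\mu}\,z_\lambda\prod_{i=1}^{\ell(\lambda)}\frac{1-q^{\lambda_i}}{1-t^{\lambda_i}},\qquad z_\lambda=\prod_{i\ge1}i^{m_i}m_i!,$$ where $m_i$ is the number of parts of $\lambda$ equal to $i$. Let $P_\lambda=P_\lambda(q,t)$ be the Macdonald polynomials, i.e. the unique family in $\Lambda_{\mathbb{F}}$, indexed by partitions, with $\langle P_\lambda,P_\mu\rangle=0$ for $\lambda\ne\mu$ and $P_\lambda=m_\lambda+\sum_{\mu<\lambda}u_{\lambda\mu}m_\mu$ with $u_{\lambda\mu}\in\mathbb{F}$ (dominance order). Put $b_\lambda=\langle P_\lambda,P_\lambda\rangle^{-1}$, $Q_\lambda=b_\lambda P_\lambda$ and $f^\lambda_{\mu\nu}=\langle Q_\lambda,P_\mu P_\nu\rangle$ (the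 $q,t$-Littlewood–Richardson coefficients), and let the skew Macdonald polynomial $P_{\lambda/\mu}\in\Lambda_{\mathbb{F}}$ be determined by $\langle P_{\lambda/\mu},Q_\nu\rangle=\langle P_\lambda,Q_\mu Q_\nu\rangle$ for all partitions $\nu$. **Proposition.** Let $\lambda,\mu$ be partitions with $\mu\subset\lambda$ (that is, $\mu_i\le\lambda_i$ for all $i$) and $\ell(\mu)<\ell(\lambda)$. Then $P_{\lambda/\mu}$ has a unique expansion as a finite linear combination $$P_{\lambda/\mu}=\sum_{\nu}r^{\lambda}_{\mu\nu}P_\nu ,\qquad r^{\lambda}_{\mu\nu}\in\mathbb{F},$$ over partitions $\nu$; only partitions with $|\nu|=|\lambda|-|\mu|$ occur in it, and $r^{\lambda}_{\mu\nu}=0$ unless $\nu_1\ge\lambda_{\ell(\mu)+1}$. Moreover, for every partition $\nu$, $r^\lambda_{\mu\nu}=0$ if and only if $f^\lambda_{\mu\nu}=0$; thus, equivalently, $f^\lambda_{\mu\nu}=0$ for every partition $\nu$ with $\nu_1<\lambda_{\ell(\mu)+1}$. -/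

import Mathlib

/-! Partitions are represented by Mathlib's Young diagrams: for `lam : YoungDiagram`, the part
`lam_(i+1)` is `lam.rowLen i`, the list of nonzero parts is `lam.rowLens`, the length is
`lam.colLen 0`, the size is `lam.card`, and containment is the order `≤`. -/

noncomputable section

namespace Macdonald

open MvPowerSeries

/-! ### Symmetric functions in countably many variables -/

/-- The ring of symmetric functions over `R`: formal power series in the variables
`x_0, x_1, x_2, …` which are of bounded degree and invariant under permutations of the variables. -/
def SymFun (R : Type*) [CommRing R] : Subalgebra R (MvPowerSeries ℕ R) where
  carrier := {f | (∀ e : Equiv.Perm ℕ, MvPowerSeries.renameEquiv R e f = f) ∧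
    ∃ N : ℕ, ∀ d : ℕ →₀ ℕ, coeff d f ≠ 0 → d.degree ≤ N}
  mul_mem' := by
    rintro f g ⟨hf, M, hM⟩ ⟨hg, N, hN⟩
    refine ⟨fun e => by rw [map_mul, hf e, hg e], M + N, fun d hd => ?_⟩
    classical
    rw [coeff_mul] at hd
    obtain ⟨⟨a, b⟩, hab, hne⟩ := Finset.exists_ne_zero_of_sum_ne_zero hd
    rw [Finset.HasAntidiagonal.mem_antidiagonal] at hab
    simp only at hab hne
    rw [← hab, map_add]
    exact add_le_add (hM a (left_ne_zero_of_mul hne)) (hN b (right_ne_zero_of_mul hne))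
  add_mem' := by
    rintro f g ⟨hf, M, hM⟩ ⟨hg, N, hN⟩
    refine ⟨fun e => by rw [map_add, hf e, hg e], max M N, fun d hd => ?_⟩
    by_cases h : coeff d f = 0
    · have : coeff d g ≠ 0 := by
        intro h'
        exact hd (by rw [map_add, h, h', add_zero])
      exact (hN d this).trans (le_max_right _ _)
    · exact (hM d h).trans (le_max_left _ _)
  algebraMap_mem' := by
    intro r
    refine ⟨fun e => AlgEquiv.commutes _ r, 0, fun d hd => ?_⟩
    classical
    rw [MvPowerSeries.algebraMap_apply, coeff_C] at hd
    have : d = 0 := by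
      by_contra h
      exact hd (by simp [h])
    simp [this]

/-- The multiset of nonzero exponents of a monomial. -/
def expParts (d : ℕ →₀ ℕ) : Multiset ℕ := d.support.val.map d

/-- The monomial symmetric function `m_lam` as a power series: the sum of all distinct monomials
whose nonzero exponents are, up to order, the parts of `lam`. -/
def msymSeries (R : Type*) [CommRing R] (lam : YoungDiagram) : MvPowerSeries ℕ R :=
  fun d => if expParts d = (lam.rowLens : Multiset ℕ) then 1 else 0

/-- The power sum `∑ i, x_i ^ r` as a power series (for `r = 0` this is `1`). -/
def psumSeries (R : Type*) [CommSemiring R] (r : ℕ) : MvPowerSeries ℕ R :=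
  open Classical in fun d => if ∃ i, d = Finsupp.single i r then 1 else 0

lemma coeff_renameEquiv (R : Type*) [CommRing R] (e : Equiv.Perm ℕ) (f : MvPowerSeries ℕ R)
    (d : ℕ →₀ ℕ) : coeff d (renameEquiv R e f) = coeff (d.mapDomain e.symm) f := by
  have h := coeff_embDomain_rename e.toEmbedding f (d.mapDomain e.symm)
  rw [Finsupp.embDomain_eq_mapDomain] at h
  rw [← h, ← Finsupp.mapDomain_comp]
  have : (e.toEmbedding : ℕ → ℕ) ∘ e.symm = id := by
    funext x
    simp
  rw [this, Finsupp.mapDomain_id]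
  rfl

lemma expParts_mapDomain (e : Equiv.Perm ℕ) (d : ℕ →₀ ℕ) :
    expParts (d.mapDomain e) = expParts d := by
  unfold expParts
  rw [Finsupp.mapDomain_support_of_injective e.injective,
    Finset.image_val_of_injOn e.injective.injOn, Multiset.map_map]
  refine Multiset.map_congr rfl fun x _ => ?_
  simp [Finsupp.mapDomain_apply e.injective]

lemma degree_eq_expParts (d : ℕ →₀ ℕ) : d.degree = (expParts d).sum := rfl

lemma msymSeries_mem (R : Type*) [CommRing R] (lam : YoungDiagram) :
    msymSeries R lam ∈ SymFun R := by
  refine ⟨fun e => ?_, (lam.rowLens : Multiset ℕ).sum, fun d hd => ?_⟩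
  · ext d
    rw [coeff_renameEquiv]
    change (if _ then (1 : R) else 0) = if _ then (1 : R) else 0
    rw [expParts_mapDomain]
  · have : expParts d = (lam.rowLens : Multiset ℕ) := by
      by_contra h
      exact hd (if_neg h)
    rw [degree_eq_expParts, this]

lemma coeff_psumSeries (R : Type*) [CommSemiring R] (r : ℕ) (d : ℕ →₀ ℕ)
    [Decidable (∃ i, d = Finsupp.single i r)] :
    coeff d (psumSeries R r) = if ∃ i, d = Finsupp.single i r then 1 else 0 := by
  refine Eq.trans (b := @ite R _ (Classical.propDecidable _) 1 0) rfl ?_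
  congr

lemma psumSeries_mem (R : Type*) [CommRing R] (r : ℕ) : psumSeries R r ∈ SymFun R := by
  classical
  refine ⟨fun e => ?_, r, fun d hd => ?_⟩
  · ext d
    rw [coeff_renameEquiv]
    rw [coeff_psumSeries, coeff_psumSeries]
    refine if_congr ⟨?_, ?_⟩ rfl rfl
    · rintro ⟨i, hi⟩
      refine ⟨e i, ?_⟩
      have h2 : (d.mapDomain e.symm).mapDomain e = d := by
        rw [← Finsupp.mapDomain_comp]
        simp
      rw [← h2, hi, Finsupp.mapDomain_single]
    · rintro ⟨i, rfl⟩
      exact ⟨e.symm i, by rw [Finsupp.mapDomain_single]⟩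
  · have : ∃ i, d = Finsupp.single i r := by
      by_contra h
      exact hd (if_neg h)
    obtain ⟨i, rfl⟩ := this
    rw [Finsupp.degree_single]

/-- The monomial symmetric function `m_lam`. -/
def msym (R : Type*) [CommRing R] (lam : YoungDiagram) : SymFun R :=
  ⟨msymSeries R lam, msymSeries_mem R lam⟩

/-- The power sum `p_r`. -/
def psum (R : Type*) [CommRing R] (r : ℕ) : SymFun R := ⟨psumSeries R r, psumSeries_mem R r⟩

/-- The power sum symmetric function `p_lam`, the product of `p_r` over the parts `r` of `lam`. -/
def psumPart (R : Type*) [CommRing R] (lam : YoungDiagram) : SymFun R :=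
  (lam.rowLens.map (psum R)).prod

/-! ### The `p_lam` form a basis in characteristic zero -/

lemma rowLens_coe_injective {lam mu : YoungDiagram}
    (h : (lam.rowLens : Multiset ℕ) = (mu.rowLens : Multiset ℕ)) : lam = mu := by
  have h1 : lam.rowLens = mu.rowLens :=
    (Multiset.coe_eq_coe.1 h).eq_of_sortedGE lam.rowLens_sorted mu.rowLens_sorted
  exact YoungDiagram.equivListRowLens.injective (Subtype.ext h1)

lemma exists_rowLens_eq (d : ℕ →₀ ℕ) :
    ∃ lam : YoungDiagram, (lam.rowLens : Multiset ℕ) = expParts d := by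
  have hs : ((expParts d).sort (· ≥ ·)).SortedGE := ((expParts d).pairwise_sort _).sortedGE
  refine ⟨YoungDiagram.ofRowLens _ hs, ?_⟩
  rw [YoungDiagram.rowLens_ofRowLens_eq_self, Multiset.sort_eq]
  intro x hx
  rw [Multiset.mem_sort] at hx
  obtain ⟨i, hi, rfl⟩ := Multiset.mem_map.1 hx
  exact Nat.pos_of_ne_zero (Finsupp.mem_support_iff.1 hi)

/-- A monomial with exponents the parts of `lam`. -/
def expo (lam : YoungDiagram) : ℕ →₀ ℕ :=
  Finsupp.onFinset (Finset.range (lam.colLen 0)) lam.rowLen (by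
    intro i hi
    rw [Finset.mem_range, ← YoungDiagram.mem_iff_lt_colLen, YoungDiagram.mem_iff_lt_rowLen]
    exact Nat.pos_of_ne_zero hi)

lemma expParts_expo (lam : YoungDiagram) : expParts (expo lam) = (lam.rowLens : Multiset ℕ) := by
  have hs : (expo lam).support = Finset.range (lam.colLen 0) := by
    ext i
    rw [Finsupp.mem_support_iff, Finset.mem_range, ← YoungDiagram.mem_iff_lt_colLen,
      YoungDiagram.mem_iff_lt_rowLen]
    exact Nat.pos_iff_ne_zero.symm
  unfold expParts
  rw [hs]
  rfl

lemma exists_list_of_map_eq {α β : Type*} (f : α → β) (w : List β) :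
    ∀ s : Multiset α, s.map f = w → ∃ l : List α, (l : Multiset α) = s ∧ l.map f = w := by
  classical
  induction w with
  | nil =>
    intro s hs
    refine ⟨[], ?_, rfl⟩
    simpa using (by simpa using hs : s = 0).symm
  | cons a w ih =>
    intro s hs
    rw [← Multiset.cons_coe] at hs
    obtain ⟨x, hx, hfx, hxs⟩ := (Multiset.map_eq_cons f s _ a).2 hs
    obtain ⟨l, hl, hlw⟩ := ih _ hxs
    refine ⟨x :: l, ?_, by simp [hfx, hlw]⟩
    rw [← Multiset.cons_coe, hl, Multiset.cons_erase hx]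

lemma exists_perm_of_expParts_eq {d d' : ℕ →₀ ℕ} (h : expParts d = expParts d') :
    ∃ e : Equiv.Perm ℕ, d = d'.mapDomain e := by
  obtain ⟨l, hl, hlw⟩ := exists_list_of_map_eq d (expParts d).toList d.support.val (by simp [expParts])
  obtain ⟨l', hl', hlw'⟩ :=
    exists_list_of_map_eq d' (expParts d).toList d'.support.val (by rw [Multiset.coe_toList, h]; rfl)
  have hlen : l'.length = l.length := by
    have := congrArg List.length (hlw.trans hlw'.symm)
    simpa using this.symm
  have nd : l.Nodup := by
    rw [← Multiset.coe_nodup, hl]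
    exact d.support.nodup
  have nd' : l'.Nodup := by
    rw [← Multiset.coe_nodup, hl']
    exact d'.support.nodup
  let x : Fin l'.length ↪ ℕ := ⟨l'.get, nd'.injective_get⟩
  let y : Fin l'.length ↪ ℕ := ⟨fun i => l.get (i.cast hlen), fun i j hij => by
    simpa using nd.injective_get hij⟩
  obtain ⟨e, he⟩ := Equiv.Perm.exists_smul_eq_embedding x y
  have hxy : ∀ i, e (x i) = y i := fun i => by rw [← he]; rfl
  have hdd : ∀ i, d (y i) = d' (x i) := by
    intro i
    have h1 : (l.map d)[i.1]? = (l'.map d')[i.1]? := by rw [hlw, hlw']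
    have h2 : i.1 < l.length := hlen ▸ i.2
    simpa [List.getElem?_eq_getElem, h2, x, y] using h1
  have ml : ∀ n, d n ≠ 0 ↔ n ∈ l := fun n => by
    rw [← Multiset.mem_coe, hl, Finset.mem_val, Finsupp.mem_support_iff]
  have ml' : ∀ n, d' n ≠ 0 ↔ n ∈ l' := fun n => by
    rw [← Multiset.mem_coe, hl', Finset.mem_val, Finsupp.mem_support_iff]
  have key : ∀ n, d (e n) = d' n := by
    intro n
    by_cases hn : n ∈ l'
    · obtain ⟨i, rfl⟩ := List.get_of_mem hn
      have := hxy i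
      change e (l'.get i) = _ at this
      rw [this]
      exact hdd i
    · have h0 : d' n = 0 := by
        by_contra h0
        exact hn ((ml' n).1 h0)
      rw [h0]
      by_contra h1
      obtain ⟨j, hj⟩ := List.get_of_mem ((ml _).1 h1)
      have h2 : e (x (j.cast hlen.symm)) = e n := by
        rw [hxy, ← hj]
        rfl
      have h3 := e.injective h2
      exact hn (h3 ▸ List.get_mem _ _)
  refine ⟨e, ?_⟩
  ext n
  obtain ⟨m, rfl⟩ := e.surjective n
  rw [key, Finsupp.mapDomain_apply e.injective]

lemma coeff_eq_of_expParts_eq {R : Type*} [CommRing R] (f : SymFun R) {d d' : ℕ →₀ ℕ}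
    (h : expParts d = expParts d') : coeff d (f : MvPowerSeries ℕ R) = coeff d' f.1 := by
  obtain ⟨e, rfl⟩ := exists_perm_of_expParts_eq h
  conv_rhs => rw [← f.2.1 e.symm, coeff_renameEquiv]
  simp

lemma finite_sum_le (N : ℕ) : {lam : YoungDiagram | lam.rowLens.sum ≤ N}.Finite := by
  have h1 : ((((Finset.range (N + 1)) ×ˢ (Finset.range (N + 1))).powerset : Set
      (Finset (ℕ × ℕ)))).Finite := Finset.finite_toSet _
  have hinj : Function.Injective YoungDiagram.cells := fun a b h => YoungDiagram.ext h
  refine (h1.preimage hinj.injOn).subset fun lam hlam => ?_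
  have hlam : lam.rowLens.sum ≤ N := hlam
  simp only [Finset.coe_powerset, Set.mem_preimage, Set.mem_powerset_iff]
  rintro ⟨i, j⟩ hij
  have hij : (i, j) ∈ lam := hij
  have hi : i < lam.rowLens.length := by
    rw [YoungDiagram.length_rowLens, ← YoungDiagram.mem_iff_lt_colLen]
    exact lam.up_left_mem le_rfl (Nat.zero_le _) hij
  have hj := YoungDiagram.mem_iff_lt_rowLen.1 hij
  have hmem : lam.rowLen i ∈ lam.rowLens := by
    rw [← YoungDiagram.get_rowLens (h := hi)]
    exact List.getElem_mem hi
  have h2 : lam.rowLen i ≤ lam.rowLens.sum := List.single_le_sum (by simp) _ hmem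
  have h3 : lam.rowLens.length ≤ lam.rowLens.sum :=
    List.length_le_sum_of_one_le _ fun x hx => lam.pos_of_mem_rowLens x hx
  simp only [Finset.coe_product, Finset.coe_range, Set.mem_prod, Set.mem_Iio]
  omega

lemma coeff_msym (R : Type*) [CommRing R] (lam : YoungDiagram) (d : ℕ →₀ ℕ)
    [Decidable (expParts d = (lam.rowLens : Multiset ℕ))] :
    coeff d (msym R lam).1 = if expParts d = (lam.rowLens : Multiset ℕ) then 1 else 0 := by
  split_ifs with h
  · exact if_pos h
  · exact if_neg h

lemma eq_sum_msym {R : Type*} [CommRing R] (f : SymFun R) : ∃ S : Finset YoungDiagram,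
    (∀ lam ∈ S, coeff (expo lam) f.1 ≠ 0) ∧
      f = ∑ lam ∈ S, coeff (expo lam) f.1 • msym R lam := by
  classical
  obtain ⟨N, hN⟩ := f.2.2
  let S := (finite_sum_le N).toFinset.filter fun lam => coeff (expo lam) f.1 ≠ 0
  refine ⟨S, fun lam hl => (Finset.mem_filter.1 hl).2, ?_⟩
  apply Subtype.ext
  ext d
  obtain ⟨mu, hmu⟩ := exists_rowLens_eq d
  have hd : coeff d f.1 = coeff (expo mu) f.1 :=
    coeff_eq_of_expParts_eq f (by rw [expParts_expo, hmu])
  have hR : coeff d (∑ lam ∈ S, coeff (expo lam) f.1 • msym R lam : SymFun R).1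
      = ∑ lam ∈ S, coeff (expo lam) f.1 * (if lam = mu then 1 else 0) := by
    rw [AddSubmonoidClass.coe_finsetSum, map_sum]
    refine Finset.sum_congr rfl fun lam _ => ?_
    have : coeff d ((coeff (expo lam) f.1 • msym R lam : SymFun R).1)
        = coeff (expo lam) f.1 * coeff d (msym R lam).1 := rfl
    rw [this, coeff_msym, ← hmu]
    congr 2
    exact propext ⟨fun h => (rowLens_coe_injective h).symm, fun h => by rw [h]⟩
  rw [hR, hd]
  simp only [mul_ite, mul_one, mul_zero, Finset.sum_ite_eq']
  split_ifs with hm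
  · rfl
  · by_contra h0
    refine hm (Finset.mem_filter.2 ⟨?_, h0⟩)
    rw [Set.Finite.mem_toFinset]
    have h1 := hN _ h0
    rw [degree_eq_expParts, expParts_expo, Multiset.sum_coe] at h1
    exact h1

/-- Product of power sums over a list. -/
def plist (R : Type*) [CommSemiring R] (s : List ℕ) : MvPowerSeries ℕ R :=
  (s.map (psumSeries R)).prod

lemma plist_map (R : Type*) [CommRing R] (s : List ℕ) (d : ℕ →₀ ℕ) :
    coeff d (plist R s) = ((coeff d (plist ℕ s) : ℕ) : R) := by
  have h : plist R s = MvPowerSeries.map (Nat.castRingHom R) (plist ℕ s) := by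
    classical
    unfold plist
    rw [map_list_prod, List.map_map]
    congr 1
    refine List.map_congr_left fun r _ => ?_
    ext d
    rw [Function.comp, coeff_map]
    rw [coeff_psumSeries, coeff_psumSeries]
    split_ifs <;> simp
  rw [h, coeff_map]
  rfl

lemma coeff_psumPart (R : Type*) [CommRing R] (lam : YoungDiagram) (d : ℕ →₀ ℕ) :
    coeff d (psumPart R lam).1 = ((coeff d (plist ℕ lam.rowLens) : ℕ) : R) := by
  rw [← plist_map]
  have : (psumPart R lam).1 = plist R lam.rowLens := by
    change (SymFun R).val _ = _
    unfold psumPart plist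
    rw [map_list_prod, List.map_map]
    rfl
  rw [this]

lemma plist_cons_ne_zero {r : ℕ} {s : List ℕ} {d : ℕ →₀ ℕ} :
    coeff d (plist ℕ (r :: s)) ≠ 0 ↔
      ∃ i b, d = Finsupp.single i r + b ∧ coeff b (plist ℕ s) ≠ 0 := by
  classical
  have h : plist ℕ (r :: s) = psumSeries ℕ r * plist ℕ s := by simp [plist]
  have hp : ∀ a, coeff a (psumSeries ℕ r) ≠ 0 ↔ ∃ i, a = Finsupp.single i r := by
    intro a
    rw [coeff_psumSeries]
    split_ifs with h <;> simp [h]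
  rw [h, coeff_mul]
  simp only [ne_eq, Finset.sum_eq_zero_iff, not_forall, mul_eq_zero, not_or]
  constructor
  · rintro ⟨⟨a, b⟩, hab, h1, h2⟩
    obtain ⟨i, rfl⟩ := (hp a).1 h1
    exact ⟨i, b, (Finset.HasAntidiagonal.mem_antidiagonal.1 hab).symm, h2⟩
  · rintro ⟨i, b, hd, hb⟩
    exact ⟨(Finsupp.single i r, b), Finset.HasAntidiagonal.mem_antidiagonal.2 hd.symm, (hp _).2 ⟨i, rfl⟩, hb⟩

lemma plist_card_support (s : List ℕ) : ∀ d : ℕ →₀ ℕ, (∀ r ∈ s, 0 < r) →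
    coeff d (plist ℕ s) ≠ 0 → d.support.card ≤ s.length ∧
      (s.length ≤ d.support.card → expParts d = (s : Multiset ℕ)) := by
  classical
  induction s with
  | nil =>
    intro d _ hd
    have : d = 0 := by
      by_contra h
      exact hd (by simp [plist, coeff_one, h])
    subst this
    simp [expParts]
  | cons r s ih =>
    intro d hs hd
    obtain ⟨i, b, rfl, hb⟩ := plist_cons_ne_zero.1 hd
    have hr : r ≠ 0 := (hs r (by simp)).ne'
    obtain ⟨h1, h2⟩ := ih b (fun x hx => hs x (by simp [hx])) hb
    have hsup : (Finsupp.single i r + b).support = insert i b.support := by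
      ext n
      by_cases hn : i = n
      · subst hn
        simp [hr]
      · simp [Ne.symm hn]
    rw [hsup, List.length_cons]
    refine ⟨(Finset.card_insert_le _ _).trans (by omega), fun h3 => ?_⟩
    by_cases hi : i ∈ b.support
    · rw [Finset.insert_eq_of_mem hi] at h3
      omega
    · rw [Finset.card_insert_of_notMem hi] at h3
      rw [← Multiset.cons_coe, ← h2 (by omega)]
      unfold expParts
      rw [hsup, Finset.insert_val_of_notMem hi, Multiset.map_cons]
      congr 1
      · simp [Finsupp.notMem_support_iff.1 hi]
      · refine Multiset.map_congr rfl fun x hx => ?_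
        have : i ≠ x := fun h => hi (h ▸ hx)
        simp [this]

lemma plist_ne_zero (s : List ℕ) : ∀ d : ℕ →₀ ℕ, expParts d = (s : Multiset ℕ) →
    coeff d (plist ℕ s) ≠ 0 := by
  classical
  induction s with
  | nil =>
    intro d hd
    have : d = 0 := by simpa [expParts] using hd
    subst this
    simp [plist]
  | cons r s ih =>
    intro d hd
    rw [← Multiset.cons_coe] at hd
    obtain ⟨i, hi, hr, hm⟩ := (Multiset.map_eq_cons d d.support.val _ r).2 hd
    refine plist_cons_ne_zero.2 ⟨i, d.erase i, ?_, ih _ ?_⟩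
    · rw [← hr, Finsupp.single_add_erase]
    · rw [← hm]
      unfold expParts
      rw [Finsupp.support_erase, Finset.erase_val]
      refine Multiset.map_congr rfl fun x hx => ?_
      have : x ≠ i := by
        rintro rfl
        exact (Multiset.Nodup.notMem_erase d.support.nodup) hx
      rw [Finsupp.erase_ne this]

lemma card_support_expo (lam : YoungDiagram) : (expo lam).support.card = lam.rowLens.length := by
  have h := congrArg Multiset.card (expParts_expo lam)
  simpa [expParts] using h

section Basis

variable (K : Type*) [Field K] [CharZero K]

lemma coeff_expo_psumPart {lam mu : YoungDiagram}
    (h : coeff (expo mu) (psumPart K lam).1 ≠ 0) :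
    mu = lam ∨ mu.rowLens.length < lam.rowLens.length := by
  rw [coeff_psumPart, Nat.cast_ne_zero] at h
  obtain ⟨h1, h2⟩ := plist_card_support _ _ lam.pos_of_mem_rowLens h
  rw [card_support_expo, expParts_expo] at *
  rcases h1.lt_or_eq with h3 | h3
  · exact Or.inr h3
  · exact Or.inl (rowLens_coe_injective (h2 h3.ge))

lemma coeff_expo_psumPart_self (lam : YoungDiagram) :
    coeff (expo lam) (psumPart K lam).1 ≠ 0 := by
  rw [coeff_psumPart, Nat.cast_ne_zero]
  exact plist_ne_zero _ _ (expParts_expo lam)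

lemma psumPart_linearIndependent : LinearIndependent K (psumPart K) := by
  classical
  rw [linearIndependent_iff]
  intro l hl
  by_contra hne
  obtain ⟨lam, hlam, hmax⟩ := Finset.exists_max_image l.support
    (fun lam => lam.rowLens.length) (Finsupp.support_nonempty_iff.2 hne)
  have h1 : coeff (expo lam) (Finsupp.linearCombination K (psumPart K) l).1 = 0 := by
    rw [hl]
    rfl
  rw [Finsupp.linearCombination_apply, Finsupp.sum, AddSubmonoidClass.coe_finsetSum, map_sum,
    Finset.sum_eq_single lam] at h1
  · have h2 : l lam * coeff (expo lam) (psumPart K lam).1 = 0 := h1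
    rcases mul_eq_zero.1 h2 with h3 | h3
    · exact (Finsupp.mem_support_iff.1 hlam) h3
    · exact coeff_expo_psumPart_self K lam h3
  · intro kap hkap hk
    change l kap * coeff (expo lam) (psumPart K kap).1 = 0
    by_contra h3
    rcases coeff_expo_psumPart K (right_ne_zero_of_mul h3) with h4 | h4
    · exact hk h4.symm
    · exact absurd (hmax kap hkap) (not_le.2 h4)
  · intro h
    exact absurd hlam h

lemma msym_mem_span (n : ℕ) : ∀ lam : YoungDiagram, lam.rowLens.length = n →
    msym K lam ∈ Submodule.span K (Set.range (psumPart K)) := by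
  classical
  induction n using Nat.strong_induction_on with
  | _ n ih =>
    intro lam hn
    obtain ⟨S, hS, hsum⟩ := eq_sum_msym (psumPart K lam)
    have hc := coeff_expo_psumPart_self K lam
    have hlam : lam ∈ S := by
      by_contra hl
      have h0 : coeff (expo lam) (psumPart K lam).1 = 0 := by
        rw [hsum, AddSubmonoidClass.coe_finsetSum, map_sum]
        refine Finset.sum_eq_zero fun mu hmu => ?_
        change _ * coeff (expo lam) (msym K mu).1 = 0
        rw [coeff_msym, if_neg, mul_zero]
        intro h
        rw [expParts_expo] at h
        exact hl (rowLens_coe_injective h ▸ hmu)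
      exact hc h0
    rw [← Finset.add_sum_erase _ _ hlam] at hsum
    have hrest : ∑ mu ∈ S.erase lam, coeff (expo mu) (psumPart K lam).1 • msym K mu ∈
        Submodule.span K (Set.range (psumPart K)) := by
      refine Submodule.sum_mem _ fun mu hmu => Submodule.smul_mem _ _ ?_
      obtain ⟨hne, hmu⟩ := Finset.mem_erase.1 hmu
      rcases coeff_expo_psumPart K (hS mu hmu) with h | h
      · exact absurd h hne
      · exact ih _ (hn ▸ h) mu rfl
    have h1 : coeff (expo lam) (psumPart K lam).1 • msym K lam ∈
        Submodule.span K (Set.range (psumPart K)) := by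
      rw [← sub_eq_iff_eq_add] at hsum
      rw [← hsum]
      exact Submodule.sub_mem _ (Submodule.subset_span ⟨lam, rfl⟩) hrest
    exact (Submodule.smul_mem_iff _ hc).1 h1

lemma psumPart_span : ⊤ ≤ Submodule.span K (Set.range (psumPart K)) := by
  intro f _
  obtain ⟨S, -, hsum⟩ := eq_sum_msym f
  rw [hsum]
  exact Submodule.sum_mem _ fun mu _ => Submodule.smul_mem _ _ (msym_mem_span K _ mu rfl)

/-- The basis of the ring of symmetric functions given by the `p_lam`. -/
def psumBasis : Module.Basis YoungDiagram K (SymFun K) :=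
  Module.Basis.mk (psumPart_linearIndependent K) (psumPart_span K)

lemma psumBasis_apply (lam : YoungDiagram) : psumBasis K lam = psumPart K lam :=
  Module.Basis.mk_apply _ _ lam

end Basis

/-! ### Macdonald polynomials -/

/-- `z_lam = ∏ i ^ (m_i) * m_i !`, where `m_i` is the number of parts of `lam` equal to `i`. -/
def zPart (lam : YoungDiagram) : ℕ :=
  ∏ i ∈ lam.rowLens.toFinset, i ^ lam.rowLens.count i * (lam.rowLens.count i).factorial

/-- `mu ≤ lam` in the dominance order on partitions of the same size. -/
def DominatedBy (mu lam : YoungDiagram) : Prop :=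
  mu.card = lam.card ∧
    ∀ k : ℕ, ∑ i ∈ Finset.range k, mu.rowLen i ≤ ∑ i ∈ Finset.range k, lam.rowLen i

section Macdonald

variable {K : Type*} [Field K] [CharZero K]

/-- The `q,t`-Hall scalar product, the bilinear form with
`⟨p_lam, p_mu⟩ = δ_(lam,mu) z_lam ∏_i (1 - q ^ lam_i) / (1 - t ^ lam_i)`. -/
def hall (q t : K) : LinearMap.BilinForm K (SymFun K) :=
  open Classical in
  (psumBasis K).constr K fun lam => (psumBasis K).constr K fun mu =>
    if lam = mu then
      (zPart lam : K) * (lam.rowLens.map fun r => (1 - q ^ r) / (1 - t ^ r)).prod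
    else 0

lemma hall_psumPart (q t : K) (lam mu : YoungDiagram) [Decidable (lam = mu)] :
    hall q t (psumPart K lam) (psumPart K mu) =
      if lam = mu then
        (zPart lam : K) * (lam.rowLens.map fun r => (1 - q ^ r) / (1 - t ^ r)).prod
      else 0 := by
  unfold hall
  rw [← psumBasis_apply, ← psumBasis_apply, Module.Basis.constr_basis, Module.Basis.constr_basis]
  congr

/-- The defining properties of the family of Macdonald polynomials: it is orthogonal for the
`q,t`-Hall scalar product, and `P_lam = m_lam + ∑_(mu < lam) u_(lam,mu) m_mu`. -/
def IsMacdonaldFamily (q t : K) (P : YoungDiagram → SymFun K) : Prop :=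
  (∀ lam mu, lam ≠ mu → hall q t (P lam) (P mu) = 0) ∧
    ∀ lam, ∃ u : YoungDiagram →₀ K, (∀ mu, u mu ≠ 0 → DominatedBy mu lam ∧ mu ≠ lam) ∧
      P lam = msym K lam + u.sum fun mu c => c • msym K mu

/-- The Macdonald polynomials `P_lam(q,t)`: the family with the properties above (there is
exactly one for generic `q, t`). -/
def macP (q t : K) : YoungDiagram → SymFun K := Classical.epsilon (IsMacdonaldFamily q t)

/-- `b_lam = ⟨P_lam, P_lam⟩⁻¹`. -/
def macB (q t : K) (lam : YoungDiagram) : K := (hall q t (macP q t lam) (macP q t lam))⁻¹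

/-- `Q_lam = b_lam P_lam`. -/
def macQ (q t : K) (lam : YoungDiagram) : SymFun K := macB q t lam • macP q t lam

/-- The `q,t`-Littlewood-Richardson coefficient `f^lam_(mu,nu) = ⟨Q_lam, P_mu P_nu⟩`. -/
def lrCoeff (q t : K) (lam mu nu : YoungDiagram) : K :=
  hall q t (macQ q t lam) (macP q t mu * macP q t nu)

/-- The skew Macdonald polynomial `P_(lam/mu)`: the symmetric function with
`⟨P_(lam/mu), Q_nu⟩ = ⟨P_lam, Q_mu Q_nu⟩` for all partitions `nu`. -/
def skewP (q t : K) (lam mu : YoungDiagram) : SymFun K :=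
  Classical.epsilon fun f : SymFun K => ∀ nu : YoungDiagram,
    hall q t f (macQ q t nu) = hall q t (macP q t lam) (macQ q t mu * macQ q t nu)

end Macdonald

/-- The field `ℚ(q,t)` of rational functions in two indeterminates. -/
abbrev QT : Type := FractionRing (MvPolynomial (Fin 2) ℚ)

/-- The indeterminate `q` of `ℚ(q,t)`. -/
def qvar : QT := algebraMap (MvPolynomial (Fin 2) ℚ) QT (MvPolynomial.X 0)

/-- The indeterminate `t` of `ℚ(q,t)`. -/
def tvar : QT := algebraMap (MvPolynomial (Fin 2) ℚ) QT (MvPolynomial.X 1)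

end Macdonald

end

noncomputable section

namespace Macdonald

/-! ### Exponential sequences -/

section ExpSeq

variable {R : Type*} [CommRing R] [Algebra ℚ R]

/-! The tool is the Macdonald operator E (`symOp`), the degree-zero coefficient of a vertex operator
acting on polynomials in the power sums. It is self-adjoint for the scalar product, and its
eigenvalue at P_lam is 1 - (1 - t⁻¹)(1 - q) ∑ q^j t^(-i), summed over the boxes (i, j) of lam, with
indices from 0. For generic q, t this number determines the set of boxes.

The main point is that E is triangular on mixed products of n functions g_r (dual to the monomial
symmetric functions) and m elementary symmetric functions. The diagonal entry at the product with
indices r is the same box sum, taken over the set `hookBoxes n m r` of n rows with m columns below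
them, which need not be a Young diagram. The other terms have indices with larger partial sums
(`symOp_hookProd`). The box (n, m) never lies in `hookBoxes n m r`. So if it lies in lam, the
eigenvalue of P_lam differs from every diagonal entry, and self-adjointness with induction along the
triangular order makes P_lam orthogonal to all these products (`hall_hookProd_eq_zero`).

On the other hand, P_mu is a combination of products of ℓ(mu) functions g_r (`mem_span_hookProd`),
and P_nu is a combination of products of nu_1 elementary functions (`msym_mem_span_esym`). Hence
⟨P_lam, P_mu P_nu⟩ = 0 as soon as (ℓ(mu), nu_1) is a box of lam, which is the inequality nu_1 <
lam_(ℓ(mu)+1). Both r and f are nonzero multiples of this pairing, and the size condition is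
homogeneity.

Since `macP` is a choice, existence of a Macdonald family is needed too: E is triangular on the
m_lam with distinct eigenvalues, so it has a triangular eigenbasis, orthogonal by self-adjointness.
Conversely any family with the defining properties consists of eigenvectors of E. -/

/-- The coefficients of `exp (∑ c_k z ^ (k + 1) / (k + 1))`. -/
def expSeq (c : ℕ → R) : ℕ → R
  | 0 => 1
  | n + 1 => (1 / ((n : ℚ) + 1)) • ∑ i : Fin (n + 1), c (n - i) * expSeq c i

lemma expSeq_zero (c : ℕ → R) : expSeq c 0 = 1 := by rw [expSeq]

lemma expSeq_succ (c : ℕ → R) (n : ℕ) :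
    ((n : R) + 1) * expSeq c (n + 1) =
      ∑ x ∈ Finset.HasAntidiagonal.antidiagonal n, c x.1 * expSeq c x.2 := by
  rw [expSeq, Fin.sum_univ_eq_sum_range (fun i => c (n - i) * expSeq c i) (n + 1),
    ← Finset.Nat.sum_antidiagonal_eq_sum_range_succ (fun i j => c j * expSeq c i),
    ← Finset.Nat.sum_antidiagonal_swap]
  have h : ((n : R) + 1) = algebraMap ℚ R ((n : ℚ) + 1) := by simp
  rw [h, ← Algebra.smul_def, smul_smul, mul_one_div_cancel (by positivity), one_smul]
  rfl

lemma natCast_succ_cancel {n : ℕ} {x y : R} (h : ((n : R) + 1) * x = ((n : R) + 1) * y) :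
    x = y := by
  have h1 : ((n : R) + 1) = algebraMap ℚ R ((n : ℚ) + 1) := by simp
  have h2 := congrArg (fun z => algebraMap ℚ R (((n : ℚ) + 1)⁻¹) * z) h
  simpa only [h1, ← mul_assoc, ← map_mul, inv_mul_cancel₀ (by positivity : ((n : ℚ) + 1) ≠ 0),
    map_one, one_mul] using h2

/-- A power series with constant term 1 is determined by its logarithmic derivative. The identities
between exponential series below reduce to checking this recursion. -/
lemma eq_expSeq {c u : ℕ → R} (h0 : u 0 = 1)
    (h : ∀ n : ℕ, ((n : R) + 1) * u (n + 1) =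
      ∑ x ∈ Finset.HasAntidiagonal.antidiagonal n, c x.1 * u x.2) (n : ℕ) :
    u n = expSeq c n := by
  induction n using Nat.strong_induction_on with
  | _ n ih =>
    cases n with
    | zero => rw [h0, expSeq_zero]
    | succ n =>
      refine natCast_succ_cancel (n := n) ?_
      rw [h, expSeq_succ]
      refine Finset.sum_congr rfl fun x hx => ?_
      rw [ih _ (Nat.lt_succ_of_le (Finset.HasAntidiagonal.antidiagonal.snd_le hx))]

lemma map_expSeq {S : Type*} [CommRing S] [Algebra ℚ S] (φ : R →+* S) (c : ℕ → R) (n : ℕ) :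
    φ (expSeq c n) = expSeq (fun k => φ (c k)) n := by
  refine eq_expSeq (u := fun n => φ (expSeq c n)) (by simp [expSeq_zero]) (fun n => ?_) n
  have := congrArg φ (expSeq_succ c n)
  simpa using this

lemma derivative_mk_expSeq (c : ℕ → R) :
    PowerSeries.derivative R (PowerSeries.mk (expSeq c)) =
      PowerSeries.mk c * PowerSeries.mk (expSeq c) := by
  ext n
  rw [PowerSeries.coeff_derivative, PowerSeries.coeff_mk, mul_comm, expSeq_succ,
    PowerSeries.coeff_mul]
  simp

lemma sum_expSeq_mul_expSeq (c d : ℕ → R) (n : ℕ) :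
    ∑ x ∈ Finset.HasAntidiagonal.antidiagonal n, expSeq c x.1 * expSeq d x.2 =
      expSeq (fun k => c k + d k) n := by
  have key : ∀ n, ∑ x ∈ Finset.HasAntidiagonal.antidiagonal n, expSeq c x.1 * expSeq d x.2 =
      PowerSeries.coeff n (PowerSeries.mk (expSeq c) * PowerSeries.mk (expSeq d)) := by
    intro n
    simp [PowerSeries.coeff_mul]
  refine eq_expSeq
    (u := fun n => ∑ x ∈ Finset.HasAntidiagonal.antidiagonal n, expSeq c x.1 * expSeq d x.2)
    (by simp [expSeq_zero]) (fun n => ?_) n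
  simp only [key]
  rw [mul_comm, ← PowerSeries.coeff_derivative, Derivation.leibniz, derivative_mk_expSeq,
    derivative_mk_expSeq]
  have : PowerSeries.mk (expSeq c) • (PowerSeries.mk d * PowerSeries.mk (expSeq d)) +
      PowerSeries.mk (expSeq d) • (PowerSeries.mk c * PowerSeries.mk (expSeq c)) =
      PowerSeries.mk (fun k => c k + d k) *
        (PowerSeries.mk (expSeq c) * PowerSeries.mk (expSeq d)) := by
    have h : PowerSeries.mk (fun k => c k + d k) = PowerSeries.mk c + PowerSeries.mk d := by
      ext n
      simp
    rw [h, smul_eq_mul, smul_eq_mul]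
    ring
  rw [this, PowerSeries.coeff_mul]
  simp

lemma expSeq_scale (s : R) (c : ℕ → R) (n : ℕ) :
    s ^ n * expSeq c n = expSeq (fun k => s ^ (k + 1) * c k) n := by
  refine eq_expSeq (u := fun n => s ^ n * expSeq c n) (by simp [expSeq_zero]) (fun n => ?_) n
  rw [mul_left_comm, expSeq_succ, Finset.mul_sum]
  refine Finset.sum_congr rfl fun x hx => ?_
  rw [← Finset.HasAntidiagonal.mem_antidiagonal.1 hx, pow_succ, pow_succ, pow_add]
  ring

lemma expSeq_geom (s : R) (n : ℕ) : expSeq (fun k => s ^ (k + 1)) n = s ^ n := by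
  refine (eq_expSeq (u := fun n => s ^ n) (by simp) (fun n => ?_) n).symm
  rw [Finset.sum_congr rfl (g := fun _ => s ^ (n + 1))]
  · simp
  · intro x hx
    rw [← Finset.HasAntidiagonal.mem_antidiagonal.1 hx, ← pow_add]
    congr 1
    ring

lemma expSeq_neg_geom (u : R) (n : ℕ) :
    expSeq (fun k => -u ^ (k + 1)) n = if n = 0 then 1 else if n = 1 then -u else 0 := by
  refine (eq_expSeq (u := fun n => if n = 0 then 1 else if n = 1 then -u else 0) (by simp)
    (fun n => ?_) n).symm
  cases n with
  | zero => simp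
  | succ n =>
    rw [Finset.Nat.sum_antidiagonal_succ']
    cases n with
    | zero => simp; ring
    | succ n =>
      rw [Finset.Nat.sum_antidiagonal_succ']
      simp
      ring

/-- The generating function is (1 - u z)/(1 - s z), the product of a geometric series and a linear
polynomial. It is the shape of the scalar factors in `Factor.Compatible`. -/
lemma expSeq_geom_sub (s u : R) (n : ℕ) :
    expSeq (fun k => s ^ (k + 1) - u ^ (k + 1)) (n + 1) = (s - u) * s ^ n := by
  simp only [sub_eq_add_neg]
  rw [← sum_expSeq_mul_expSeq]
  rw [Finset.Nat.sum_antidiagonal_succ']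
  cases n with
  | zero => simp [expSeq_geom, expSeq_neg_geom, expSeq_zero]
  | succ n =>
    rw [Finset.Nat.sum_antidiagonal_succ']
    simp [expSeq_geom, expSeq_neg_geom]
    ring

end ExpSeq

/-! ### Shifts of the power sums and their adjoints -/

section Shift

variable {K : Type*} [Field K]

lemma sum_antidiagonal_shift {A : Type*} [AddCommMonoid A] (G : ℕ → ℕ → A) (n k : ℕ) :
    ∑ x ∈ Finset.HasAntidiagonal.antidiagonal n, (if k ≤ x.2 then G x.1 (x.2 - k) else 0) =
      if k ≤ n then ∑ x ∈ Finset.HasAntidiagonal.antidiagonal (n - k), G x.1 x.2 else 0 := by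
  rw [Finset.Nat.sum_antidiagonal_eq_sum_range_succ (fun i j => if k ≤ j then G i (j - k) else 0)]
  split_ifs with h
  · obtain ⟨m, rfl⟩ := Nat.exists_eq_add_of_le' h
    rw [Finset.Nat.sum_antidiagonal_eq_sum_range_succ G, Nat.add_sub_cancel,
      show (m + k).succ = (m + 1) + k by omega, Finset.sum_range_add]
    rw [Finset.sum_eq_zero (s := Finset.range k), add_zero]
    · refine Finset.sum_congr rfl fun i hi => ?_
      have := Finset.mem_range.1 hi
      rw [if_pos (by omega)]
      congr 1
      omega
    · intro i hi
      have := Finset.mem_range.1 hi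
      rw [if_neg (by omega)]
  · refine Finset.sum_eq_zero fun i _ => if_neg (by omega)

/-- The algebra homomorphism sending the generator `X k`, which stands for the power sum of degree
`k + 1`, to `X k + κ k * z ^ (k + 1)`. -/
def shiftHom (κ : ℕ → K) : MvPolynomial ℕ K →ₐ[K] Polynomial (MvPolynomial ℕ K) :=
  MvPolynomial.aeval fun k =>
    Polynomial.C (MvPolynomial.X k) + Polynomial.C (MvPolynomial.C (κ k)) * Polynomial.X ^ (k + 1)

lemma shiftHom_X (κ : ℕ → K) (k : ℕ) : shiftHom κ (MvPolynomial.X k) =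
    Polynomial.C (MvPolynomial.X k) +
      Polynomial.C (MvPolynomial.C (κ k)) * Polynomial.X ^ (k + 1) := by
  simp [shiftHom]

lemma shiftHom_C (κ : ℕ → K) (a : K) :
    shiftHom κ (MvPolynomial.C a) = Polynomial.C (MvPolynomial.C a) := by
  rw [shiftHom, MvPolynomial.aeval_C]
  rfl

lemma coeff_shiftHom_mul_X (κ : ℕ → K) (v : MvPolynomial ℕ K) (k n : ℕ) :
    (shiftHom κ (v * MvPolynomial.X k)).coeff n =
      (shiftHom κ v).coeff n * MvPolynomial.X k +
        if k + 1 ≤ n then κ k • (shiftHom κ v).coeff (n - (k + 1)) else 0 := by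
  rw [map_mul, shiftHom_X, mul_add, Polynomial.coeff_add, Polynomial.coeff_mul_C, ← mul_assoc,
    Polynomial.coeff_mul_X_pow']
  congr 1
  split_ifs
  · rw [Polynomial.coeff_mul_C, mul_comm, MvPolynomial.smul_eq_C_mul]
  · rfl

lemma coeff_zero_shiftHom (κ : ℕ → K) (v : MvPolynomial ℕ K) : (shiftHom κ v).coeff 0 = v := by
  induction v using MvPolynomial.induction_on with
  | C a => rw [shiftHom_C, Polynomial.coeff_C_zero]
  | add u v hu hv => rw [map_add, Polynomial.coeff_add, hu, hv]
  | mul_X v k hv => rw [coeff_shiftHom_mul_X, hv, if_neg (by omega), add_zero]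

/-- The chain rule in z: differentiating the translated polynomial brings down the partial
derivative in each variable, with weight (k + 1) κ_k z^k. -/
lemma coeff_succ_shiftHom (κ : ℕ → K) (v : MvPolynomial ℕ K) : ∀ n : ℕ,
    ((n : K) + 1) • (shiftHom κ v).coeff (n + 1) =
      ∑ x ∈ Finset.HasAntidiagonal.antidiagonal n, (((x.1 : K) + 1) * κ x.1) •
        (shiftHom κ (MvPolynomial.pderiv x.1 v)).coeff x.2 := by
  induction v using MvPolynomial.induction_on with
  | C a =>
    intro n
    simp [Polynomial.coeff_C_succ]
  | add u v hu hv =>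
    intro n
    simp only [map_add, Polynomial.coeff_add, smul_add, Finset.sum_add_distrib, hu, hv]
  | mul_X v k hv =>
    intro n
    have h1 : ∀ x : ℕ × ℕ, (((x.1 : K) + 1) * κ x.1) •
        (shiftHom κ (MvPolynomial.pderiv x.1 (v * MvPolynomial.X k))).coeff x.2 =
        ((((x.1 : K) + 1) * κ x.1) • (shiftHom κ (MvPolynomial.pderiv x.1 v)).coeff x.2) *
          MvPolynomial.X k +
        κ k • (if k + 1 ≤ x.2 then (((x.1 : K) + 1) * κ x.1) •
          (shiftHom κ (MvPolynomial.pderiv x.1 v)).coeff (x.2 - (k + 1)) else 0) +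
        (if k = x.1 then (((k : K) + 1) * κ k) • (shiftHom κ v).coeff x.2 else 0) := by
      intro x
      have hd : MvPolynomial.pderiv x.1 (v * MvPolynomial.X k) =
          MvPolynomial.pderiv x.1 v * MvPolynomial.X k + if k = x.1 then v else 0 := by
        rw [Derivation.leibniz, MvPolynomial.pderiv_X, smul_eq_mul, smul_eq_mul,
          add_comm (v * _), mul_comm (MvPolynomial.X k)]
        congr 1
        by_cases h : k = x.1
        · subst h
          simp
        · rw [if_neg h, Pi.single_eq_of_ne h, mul_zero]
      rw [hd, map_add, Polynomial.coeff_add, coeff_shiftHom_mul_X, smul_add, smul_add,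
        smul_mul_assoc]
      congr 1
      · congr 1
        split_ifs
        · rw [smul_comm]
        · simp
      · by_cases h : k = x.1
        · subst h
          simp
        · rw [if_neg h, if_neg h]
          simp
    rw [Finset.sum_congr rfl fun x _ => h1 x, Finset.sum_add_distrib, Finset.sum_add_distrib,
      ← Finset.sum_mul, ← hv, ← Finset.smul_sum,
      sum_antidiagonal_shift (fun i j => (((i : K) + 1) * κ i) •
        (shiftHom κ (MvPolynomial.pderiv i v)).coeff j), coeff_shiftHom_mul_X, smul_add,
      smul_mul_assoc, add_assoc]
    congr 1
    rw [Finset.Nat.sum_antidiagonal_eq_sum_range_succ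
      (fun i j => if k = i then (((k : K) + 1) * κ k) • (shiftHom κ v).coeff j else 0),
      Finset.sum_ite_eq]
    by_cases h : k < n
    · obtain ⟨m, rfl⟩ := Nat.exists_eq_add_of_lt h
      rw [if_pos (by omega), if_pos (by omega), if_pos (by simp; omega),
        show k + m + 1 - (k + 1) = m by omega, ← hv,
        show k + m + 1 + 1 - (k + 1) = m + 1 by omega, show k + m + 1 - k = m + 1 by omega,
        smul_smul, smul_smul, ← add_smul]
      congr 1
      push_cast
      ring
    · by_cases h2 : k = n
      · subst h2
        simp [smul_smul]
      · rw [if_neg (by omega), if_neg (by omega), if_neg (by simp; omega)]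
        simp

variable [CharZero K]

/-- Multiplication by a variable is adjoint to a multiple of its partial derivative, so
multiplication by the exponential of a linear form is adjoint to the exponential of a
constant-coefficient derivation, which is a translation. The recursions `expSeq_succ` and
`coeff_succ_shiftHom` match term by term. -/
lemma expSeq_adjoint (F : LinearMap.BilinForm K (MvPolynomial ℕ K)) {w c κ : ℕ → K}
    (hF : ∀ k u v, F (MvPolynomial.X k * u) v = w k * F u (MvPolynomial.pderiv k v))
    (hκ : ∀ k : ℕ, ((k : K) + 1) * κ k = c k * w k) (n : ℕ) :
    ∀ u v, F (expSeq (fun k => MvPolynomial.C (c k) * MvPolynomial.X k) n * u) v =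
      F u ((shiftHom κ v).coeff n) := by
  induction n using Nat.strong_induction_on with
  | _ n ih =>
    cases n with
    | zero =>
      intro u v
      rw [expSeq_zero, one_mul, coeff_zero_shiftHom]
    | succ n =>
      intro u v
      have hn : ((n : K) + 1) ≠ 0 := by exact_mod_cast n.succ_ne_zero
      refine mul_left_cancel₀ hn ?_
      have h1 := expSeq_succ
        (fun k => (MvPolynomial.C (c k) * MvPolynomial.X k : MvPolynomial ℕ K)) n
      have h2 : ((n : MvPolynomial ℕ K) + 1) = MvPolynomial.C ((n : K) + 1) := by simp
      rw [h2, ← MvPolynomial.smul_eq_C_mul] at h1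
      have e1 : ∀ x : MvPolynomial ℕ K, ((n : K) + 1) * F (x * u) v =
          F (((n : K) + 1) • x * u) v := fun x => by
        rw [smul_mul_assoc, map_smul, LinearMap.smul_apply, smul_eq_mul]
      rw [e1, h1, ← smul_eq_mul ((n : K) + 1), ← map_smul, coeff_succ_shiftHom, Finset.sum_mul,
        map_sum, map_sum, LinearMap.sum_apply]
      refine Finset.sum_congr rfl fun x hx => ?_
      rw [mul_assoc, mul_assoc, ← MvPolynomial.smul_eq_C_mul, map_smul, LinearMap.smul_apply, hF,
        ih _ (Nat.lt_succ_of_le (Finset.HasAntidiagonal.antidiagonal.snd_le hx)), map_smul,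
        hκ, smul_eq_mul, smul_eq_mul, mul_assoc]

/-- Translating the exponential of a linear form multiplies it by a scalar exponential series in z.
-/
lemma shiftHom_expSeq (κ c : ℕ → K) (n : ℕ) :
    shiftHom κ (expSeq (fun k => MvPolynomial.C (c k) * MvPolynomial.X k) n) =
      ∑ i ∈ Finset.range (n + 1), Polynomial.C
        (expSeq (fun k => c k * κ k) i •
          expSeq (fun k => MvPolynomial.C (c k) * MvPolynomial.X k) (n - i)) *
        Polynomial.X ^ i := by
  have h := map_expSeq (shiftHom κ : MvPolynomial ℕ K →+* Polynomial (MvPolynomial ℕ K))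
    (fun k => MvPolynomial.C (c k) * MvPolynomial.X k) n
  rw [RingHom.coe_coe] at h
  rw [h]
  have h1 : (fun k => shiftHom κ (MvPolynomial.C (c k) * MvPolynomial.X k)) =
      fun k => (Polynomial.X ^ (k + 1) *
        (Polynomial.C.comp MvPolynomial.C : K →+* Polynomial (MvPolynomial ℕ K)) (c k * κ k)) +
        Polynomial.C (MvPolynomial.C (c k) * MvPolynomial.X k) := by
    funext k
    rw [map_mul, shiftHom_C, shiftHom_X]
    simp only [map_mul, RingHom.comp_apply]
    ring
  rw [h1, ← sum_expSeq_mul_expSeq, Finset.Nat.sum_antidiagonal_eq_sum_range_succ_mk]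
  refine Finset.sum_congr rfl fun i _ => ?_
  rw [← expSeq_scale, ← map_expSeq, ← map_expSeq, MvPolynomial.smul_eq_C_mul, map_mul]
  simp only [RingHom.comp_apply]
  ring

end Shift

/-! ### Triangularity of vertex operators -/

section Vertex

variable {K R : Type*} [Field K] [CommRing R] [Algebra K R]

/-- `∑_l Q_l z ^ (-l) ↦` the coefficient of `z ^ (-d)` in `(∑_k α_k z ^ k) * (∑_l Q_l z ^ (-l))`. -/
def theta (α : ℕ → R) (d : ℕ) : Polynomial R →ₗ[R] R :=
  Polynomial.lsum fun l => if d ≤ l then LinearMap.mulRight R (α (l - d)) else 0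

lemma theta_C_mul_X_pow (α : ℕ → R) (d l : ℕ) (r : R) :
    theta α d (Polynomial.C r * Polynomial.X ^ l) = if d ≤ l then r * α (l - d) else 0 := by
  rw [theta, Polynomial.C_mul_X_pow_eq_monomial, Polynomial.lsum_apply,
    Polynomial.sum_monomial_index _ _ (by simp)]
  split_ifs <;> simp

/-- The vertex operator: the coefficient of `z ^ (-d)` in `(∑_k α_k z ^ k) * B h`. -/
def vertexOp (α : ℕ → R) (B : R →ₐ[K] Polynomial R) (d : ℕ) : R →ₗ[K] R :=
  (theta α d).restrictScalars K ∘ₗ B.toLinearMap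

lemma vertexOp_apply (α : ℕ → R) (B : R →ₐ[K] Polynomial R) (d : ℕ) (h : R) :
    vertexOp α B d h = theta α d (B h) := rfl

/-- A sequence of elements of `R` with three parameters that govern how it interacts with a vertex
operator. -/
structure Factor (K R : Type*) where
  /-- the sequence -/
  seq : ℕ → R
  /-- the constant term of the shift -/
  c : K
  /-- the location of the pole of the shift -/
  s : K
  /-- the resulting rescaling -/
  p : K

/-- The conditions which make products of terms of `φ.seq` triangular for the vertex operator. -/
structure Factor.Compatible (φ : Factor K R) (α : ℕ → R) (B : R →ₐ[K] Polynomial R) : Prop where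
  s_ne : φ.s ≠ 0
  -- In generating series: α(s w) φ(w) = φ(p w).
  fusion : ∀ a : ℕ, ∑ k ∈ Finset.range (a + 1), φ.s ^ k • (α k * φ.seq (a - k)) =
    φ.p ^ a • φ.seq a
  -- In generating series, with `Polynomial.X` standing for 1/z and x = s w/z: B φ(w) = φ(w) (1 - c
  -- x)/(1 - x), where the fraction equals c + (1 - c)/(1 - x).
  shift : ∀ a : ℕ, B (φ.seq a) = ∑ i ∈ Finset.range (a + 1), Polynomial.C
    ((if i = 0 then 1 else (1 - φ.c) * φ.s ^ i) • φ.seq (a - i)) * Polynomial.X ^ i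

/-- The part of the vertex operator on a product that comes from the rescaled first factor. -/
def residue (φ : Factor K R) (d a : ℕ) : Polynomial R →ₗ[R] R :=
  Polynomial.lsum fun l => if d ≤ a + l then
    LinearMap.mulRight R (((φ.s ^ l)⁻¹ * φ.s ^ d * φ.p ^ (a + l - d)) • φ.seq (a + l - d)) else 0

lemma residue_C_mul_X_pow (φ : Factor K R) (d a l : ℕ) (r : R) :
    residue φ d a (Polynomial.C r * Polynomial.X ^ l) = if d ≤ a + l then
      r * ((φ.s ^ l)⁻¹ * φ.s ^ d * φ.p ^ (a + l - d)) • φ.seq (a + l - d) else 0 := by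
  rw [residue, Polynomial.C_mul_X_pow_eq_monomial, Polynomial.lsum_apply,
    Polynomial.sum_monomial_index _ _ (by simp)]
  split_ifs <;> simp

variable {α : ℕ → R} {B : R →ₐ[K] Polynomial R} {φ : Factor K R}

/-- The first sum comes from expanding 1/(1 - x) in powers of x = s w/z, and the second supplies the
negative powers, completing the formal delta function ∑ x^n over all integers n. Multiplying by the
delta function sets z = s w, where α(z) φ(w) fuses to φ(p w). The bound `l ≤ J` ensures that no
nonzero negative power is cut off. -/
lemma fusion_sum (hφ : φ.Compatible α B) (d a l J : ℕ) (hl : l ≤ J) :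
    (∑ i ∈ Finset.range (a + 1), if d ≤ i + l then φ.s ^ i • (φ.seq (a - i) * α (i + l - d)) else 0)
      + ∑ j ∈ Finset.range J, (φ.s ^ (j + 1))⁻¹ • (φ.seq (a + j + 1) *
        if d + j + 1 ≤ l then α (l - (d + j + 1)) else 0) =
    if d ≤ a + l then
      ((φ.s ^ l)⁻¹ * φ.s ^ d * φ.p ^ (a + l - d)) • φ.seq (a + l - d) else 0 := by
  have hs := hφ.s_ne
  rcases le_total d l with h | h
  · obtain ⟨g, rfl⟩ := Nat.exists_eq_add_of_le h
    rw [if_pos (by omega), show a + (d + g) - d = g + a by omega, mul_smul _ _ (φ.seq _),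
      ← hφ.fusion, show g + a + 1 = g + (a + 1) by ring, Finset.sum_range_add _ g (a + 1), smul_add,
      add_comm]
    have hsg : (φ.s ^ (d + g))⁻¹ * φ.s ^ d = (φ.s ^ g)⁻¹ := by
      rw [pow_add]
      field_simp
    rw [hsg]
    congr 1
    · rw [← Finset.sum_range_reflect (fun k => φ.s ^ k • (α k * φ.seq (g + a - k))) g,
        Finset.smul_sum]
      refine (Finset.sum_subset (Finset.range_mono (by omega : g ≤ J)) ?_).symm.trans ?_
      · intro j _ hj
        rw [if_neg (by simpa using hj), mul_zero, smul_zero]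
      · refine Finset.sum_congr rfl fun j hj => ?_
        have hj := Finset.mem_range.1 hj
        obtain ⟨k, rfl⟩ := Nat.exists_eq_add_of_lt hj
        rw [if_pos (by omega), show d + (j + k + 1) - (d + j + 1) = k by omega,
          show j + k + 1 - 1 - j = k by omega, show j + k + 1 + a - k = a + j + 1 by omega,
          smul_smul, mul_comm (φ.seq _)]
        congr 1
        rw [show j + k + 1 = (j + 1) + k by ring, pow_add]
        field_simp
        ring
    · rw [Finset.smul_sum]
      refine Finset.sum_congr rfl fun i hi => ?_
      rw [if_pos (by omega), show i + (d + g) - d = g + i by omega,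
        show g + a - (g + i) = a - i by omega, smul_smul, mul_comm (φ.seq _)]
      congr 1
      rw [pow_add]
      field_simp
  · obtain ⟨e, rfl⟩ := Nat.exists_eq_add_of_le h
    rw [Finset.sum_eq_zero (s := Finset.range J), add_zero]
    · split_ifs with h2
      · obtain ⟨b, rfl⟩ := Nat.exists_eq_add_of_le (by omega : e ≤ a)
        rw [show e + b + 1 = e + (b + 1) by ring, Finset.sum_range_add _ e (b + 1),
          Finset.sum_eq_zero, zero_add,
          show e + b + l - (l + e) = b by omega, mul_smul _ _ (φ.seq _), ← hφ.fusion,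
          Finset.smul_sum]
        · refine Finset.sum_congr rfl fun i hi => ?_
          rw [if_pos (by omega), show e + i + l - (l + e) = i by omega,
            show e + b - (e + i) = b - i by omega, smul_smul, mul_comm (φ.seq _)]
          congr 1
          rw [pow_add, pow_add]
          field_simp
        · intro i hi
          have := Finset.mem_range.1 hi
          rw [if_neg (by omega)]
      · refine Finset.sum_eq_zero fun i hi => ?_
        have := Finset.mem_range.1 hi
        rw [if_neg (by omega)]
    · intro j _
      rw [if_neg (by omega), mul_zero, smul_zero]

lemma theta_shift_mul_monomial (hφ : φ.Compatible α B) (d a l J : ℕ) (hl : l ≤ J) (r : R) :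
    theta α d (B (φ.seq a) * (Polynomial.C r * Polynomial.X ^ l)) =
      φ.c • (φ.seq a * theta α d (Polynomial.C r * Polynomial.X ^ l)) +
      (1 - φ.c) • residue φ d a (Polynomial.C r * Polynomial.X ^ l) -
      (1 - φ.c) • ∑ j ∈ Finset.range J, (φ.s ^ (j + 1))⁻¹ • (φ.seq (a + j + 1) *
        theta α (d + j + 1) (Polynomial.C r * Polynomial.X ^ l)) := by
  have h1 : ∀ i, Polynomial.C ((if i = 0 then (1 : K) else (1 - φ.c) * φ.s ^ i) • φ.seq (a - i)) *
      Polynomial.X ^ i * (Polynomial.C r * Polynomial.X ^ l) =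
      Polynomial.C (((if i = 0 then (1 : K) else (1 - φ.c) * φ.s ^ i) • φ.seq (a - i)) * r) *
        Polynomial.X ^ (i + l) := by
    intro i
    rw [Polynomial.C_mul, pow_add]
    ring
  have h2 : ∀ i, theta α d (Polynomial.C (((if i = 0 then (1 : K) else (1 - φ.c) * φ.s ^ i) •
      φ.seq (a - i)) * r) * Polynomial.X ^ (i + l)) =
      (1 - φ.c) • ((if d ≤ i + l then φ.s ^ i • (φ.seq (a - i) * α (i + l - d)) else 0) * r) +
      if i = 0 then φ.c • (φ.seq a * if d ≤ l then r * α (l - d) else 0) else 0 := by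
    intro i
    rw [theta_C_mul_X_pow]
    by_cases hi : i = 0
    · subst hi
      simp only [if_true, zero_add, pow_zero, one_smul, Nat.sub_zero]
      split_ifs
      · simp only [Algebra.smul_def, map_sub, map_one]
        ring
      · simp
    · simp only [if_neg hi]
      split_ifs
      · simp only [Algebra.smul_def, map_mul, map_sub, map_one]
        ring
      · simp
  rw [hφ.shift, Finset.sum_mul, map_sum]
  simp only [h1, h2]
  rw [Finset.sum_add_distrib, Finset.sum_ite_eq', if_pos (by simp), ← Finset.smul_sum,
    ← Finset.sum_mul, eq_sub_of_add_eq (fusion_sum hφ d a l J hl), residue_C_mul_X_pow,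
    theta_C_mul_X_pow]
  simp only [theta_C_mul_X_pow]
  rw [sub_mul, smul_sub, Finset.sum_mul, add_comm, add_sub_assoc]
  congr 2
  · congr 1
    split_ifs
    · rw [mul_comm]
    · rw [zero_mul]
  · congr 1
    refine Finset.sum_congr rfl fun j _ => ?_
    rw [smul_mul_assoc]
    congr 1
    split_ifs
    · ring
    · ring

/-- Write (1 - c x)/(1 - x) as c + (1 - c)(δ(x) - ∑ x^(-j-1)), with j ≥ 0. The constant c passes the
factor through the operator, the delta function gives `residue`, and each negative power raises the
index of the factor by j + 1 while the operator applied to the rest lowers degree by j + 1 more. -/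
lemma theta_shift_mul (hφ : φ.Compatible α B) (d a : ℕ) (Q : Polynomial R) :
    theta α d (B (φ.seq a) * Q) =
      φ.c • (φ.seq a * theta α d Q) + (1 - φ.c) • residue φ d a Q -
      (1 - φ.c) • ∑ j ∈ Finset.range Q.natDegree, (φ.s ^ (j + 1))⁻¹ • (φ.seq (a + j + 1) *
        theta α (d + j + 1) Q) := by
  -- A common cutoff J makes the right-hand side additive in Q, which the number of terms
  -- `Q.natDegree` alone would prevent.
  have key : ∀ J, Q.natDegree ≤ J → theta α d (B (φ.seq a) * Q) =
      φ.c • (φ.seq a * theta α d Q) + (1 - φ.c) • residue φ d a Q -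
      (1 - φ.c) • ∑ j ∈ Finset.range J, (φ.s ^ (j + 1))⁻¹ • (φ.seq (a + j + 1) *
        theta α (d + j + 1) Q) := by
    intro J
    refine Polynomial.induction_with_natDegree_le (fun Q => theta α d (B (φ.seq a) * Q) =
      φ.c • (φ.seq a * theta α d Q) + (1 - φ.c) • residue φ d a Q -
      (1 - φ.c) • ∑ j ∈ Finset.range J, (φ.s ^ (j + 1))⁻¹ • (φ.seq (a + j + 1) *
        theta α (d + j + 1) Q)) J (by simp) ?_ ?_ Q
    · intro l r _ hl
      exact theta_shift_mul_monomial hφ d a l J hl r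
    · intro f g _ _ hf hg
      simp only [mul_add, map_add, smul_add, Finset.sum_add_distrib] at hf hg ⊢
      rw [hf, hg]
      abel
  exact key _ le_rfl

end Vertex

/-! ### Dominance of index sequences and triangularity on products of factors -/

section Triangular

variable {K R : Type*} [Field K] [CommRing R] [Algebra K R]

/-- The product of the terms `r 0, r 1, …` of the sequences in the list. -/
def factorProd : List (Factor K R) → (ℕ → ℕ) → R
  | [], _ => 1
  | φ :: Φ, r => φ.seq (r 0) * factorProd Φ fun i => r (i + 1)

/-- The sequences `r'` supported in the first `N` places, with sum `d` less than that of `r`, and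
all of whose partial sums are at least those of `r` minus `d`. -/
def dominating (N d : ℕ) (r : ℕ → ℕ) : Set (ℕ → ℕ) :=
  {r' | (∀ i, N ≤ i → r' i = 0) ∧
    ∑ i ∈ Finset.range N, r' i + d = ∑ i ∈ Finset.range N, r i ∧
    ∀ j, ∑ i ∈ Finset.range j, r i ≤ ∑ i ∈ Finset.range j, r' i + d}

/-- Prepend an entry to a sequence. -/
def consSeq (a : ℕ) (r : ℕ → ℕ) : ℕ → ℕ
  | 0 => a
  | n + 1 => r n

lemma consSeq_mem_dominating {N d D b : ℕ} {r r' : ℕ → ℕ}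
    (hr' : r' ∈ dominating N d fun i => r (i + 1)) (hb : b + D = r 0 + d) :
    consSeq b r' ∈ dominating (N + 1) D r := by
  obtain ⟨h1, h2, h3⟩ := hr'
  simp only at h2 h3
  refine ⟨fun i hi => ?_, ?_, fun j => ?_⟩
  · cases i with
    | zero => omega
    | succ i => exact h1 i (by omega)
  · rw [Finset.sum_range_succ', Finset.sum_range_succ' r]
    simp only [consSeq]
    omega
  · cases j with
    | zero => simp
    | succ j =>
      rw [Finset.sum_range_succ', Finset.sum_range_succ' (consSeq b r')]
      simp only [consSeq]
      have := h3 j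
      omega

variable {α : ℕ → R} {B : R →ₐ[K] Polynomial R}

lemma seq_mul_mem_span {Φ : List (Factor K R)} {φ : Factor K R} {S T : Set (ℕ → ℕ)} {b : ℕ}
    (h : ∀ r ∈ S, consSeq b r ∈ T) {x : R} (hx : x ∈ Submodule.span K (factorProd Φ '' S)) :
    φ.seq b * x ∈ Submodule.span K (factorProd (φ :: Φ) '' T) := by
  induction hx using Submodule.span_induction with
  | mem x hx =>
    obtain ⟨r, hr, rfl⟩ := hx
    exact Submodule.subset_span ⟨consSeq b r, h r hr, rfl⟩
  | zero => rw [mul_zero]; exact Submodule.zero_mem _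
  | add x y _ _ hx hy => rw [mul_add]; exact Submodule.add_mem _ hx hy
  | smul c x _ hx => rw [mul_smul_comm]; exact Submodule.smul_mem _ _ hx

/-- The shift only lowers indices. Its l-th coefficient removes l from them in total, so every
partial sum drops by at most l. -/
lemma coeff_shift_mem_span {Φ : List (Factor K R)} (hΦ : ∀ φ ∈ Φ, Factor.Compatible φ α B)
    (r : ℕ → ℕ) (hr : ∀ i, Φ.length ≤ i → r i = 0) (l : ℕ) :
    (B (factorProd Φ r)).coeff l ∈
      Submodule.span K (factorProd Φ '' dominating Φ.length l r) := by
  induction Φ generalizing r l with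
  | nil =>
    rw [factorProd, map_one, Polynomial.coeff_one]
    split_ifs with h
    · subst h
      refine Submodule.subset_span ⟨fun _ => 0, ⟨fun _ _ => rfl, by simp, fun j => ?_⟩, rfl⟩
      simp [hr]
    · exact Submodule.zero_mem _
  | cons φ Φ ih =>
    rw [factorProd, map_mul, (hΦ φ (by simp)).shift, Finset.sum_mul, Polynomial.finsetSum_coeff]
    refine Submodule.sum_mem _ fun i hi => ?_
    have hi := Finset.mem_range.1 hi
    rw [mul_assoc, Polynomial.coeff_C_mul, Polynomial.coeff_X_pow_mul', smul_mul_assoc]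
    refine Submodule.smul_mem _ _ ?_
    split_ifs with h
    · exact seq_mul_mem_span (fun r' hr' => consSeq_mem_dominating hr' (by omega))
        (ih (fun φ hφ => hΦ φ (by simp [hφ])) (fun i => r (i + 1))
          (fun i hi => hr _ (by simpa using hi)) (l - i))
    · rw [mul_zero]
      exact Submodule.zero_mem _

lemma residue_apply (φ : Factor K R) (d a : ℕ) (Q : Polynomial R) :
    residue φ d a Q = ∑ l ∈ Q.support, if d ≤ a + l then
      ((φ.s ^ l)⁻¹ * φ.s ^ d * φ.p ^ (a + l - d)) • (φ.seq (a + l - d) * Q.coeff l) else 0 := by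
  rw [residue, Polynomial.lsum_apply, Polynomial.sum_def]
  refine Finset.sum_congr rfl fun l _ => ?_
  split_ifs
  · simp [mul_comm]
  · rfl

/-- In the three terms of `theta_shift_mul` the first index becomes r 0, r 0 + l - d or r 0 + j + 1,
while the tail loses d, l or d + j + 1. The total loss is always d, and no partial sum loses more
than d. -/
lemma vertexOp_mem_span {Φ : List (Factor K R)} (hα : α 0 = 1)
    (hΦ : ∀ φ ∈ Φ, Factor.Compatible φ α B) (r : ℕ → ℕ)
    (hr : ∀ i, Φ.length ≤ i → r i = 0) (d : ℕ) :
    vertexOp α B d (factorProd Φ r) ∈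
      Submodule.span K (factorProd Φ '' dominating Φ.length d r) := by
  induction Φ generalizing r d with
  | nil =>
    have h := theta_C_mul_X_pow α d 0 1
    rw [Polynomial.C_1, pow_zero, one_mul, one_mul] at h
    rw [factorProd, vertexOp_apply, map_one, h]
    split_ifs with h
    · obtain rfl : d = 0 := by omega
      rw [Nat.sub_zero, hα]
      refine Submodule.subset_span ⟨fun _ => 0, ⟨fun _ _ => rfl, by simp, fun j => ?_⟩, rfl⟩
      simp [hr]
    · exact Submodule.zero_mem _
  | cons φ Φ ih =>
    have hΦ' : ∀ φ ∈ Φ, Factor.Compatible φ α B := fun φ hφ => hΦ φ (by simp [hφ])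
    have hr' : ∀ i, Φ.length ≤ i → r (i + 1) = 0 := fun i hi => hr _ (by simpa using hi)
    rw [factorProd, vertexOp_apply, map_mul, theta_shift_mul (hΦ φ (by simp))]
    refine Submodule.sub_mem _ (Submodule.add_mem _ (Submodule.smul_mem _ _ ?_)
      (Submodule.smul_mem _ _ ?_)) (Submodule.smul_mem _ _ ?_)
    · exact seq_mul_mem_span (fun r' h => consSeq_mem_dominating h rfl) (ih hΦ' _ hr' d)
    · rw [residue_apply]
      refine Submodule.sum_mem _ fun l _ => ?_
      split_ifs with h
      · exact Submodule.smul_mem _ _ (seq_mul_mem_span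
          (fun r' h => consSeq_mem_dominating h (by omega)) (coeff_shift_mem_span hΦ' _ hr' l))
      · exact Submodule.zero_mem _
    · refine Submodule.sum_mem _ fun j _ => Submodule.smul_mem _ _ ?_
      exact seq_mul_mem_span (fun r' h => consSeq_mem_dominating h (by omega))
        (ih hΦ' _ hr' (d + j + 1))

/-- The diagonal entry of the vertex operator at a product. -/
def vertexEigenvalue : List (Factor K R) → (ℕ → ℕ) → K
  | [], _ => 1
  | φ :: Φ, r => (1 - φ.c) * φ.p ^ r 0 + φ.c * vertexEigenvalue Φ fun i => r (i + 1)

/-- The first index is kept only by the term c times the operator on the tail, treated by induction,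
and by the l = 0 part of the residue, which gives (1 - c) p^(r 0). Every other term strictly raises
the first index. -/
lemma vertexOp_sub_mem_span {Φ : List (Factor K R)} (hα : α 0 = 1) (hB : ∀ h, (B h).coeff 0 = h)
    (hΦ : ∀ φ ∈ Φ, Factor.Compatible φ α B) (r : ℕ → ℕ) (hr : ∀ i, Φ.length ≤ i → r i = 0) :
    vertexOp α B 0 (factorProd Φ r) - vertexEigenvalue Φ r • factorProd Φ r ∈
      Submodule.span K (factorProd Φ '' (dominating Φ.length 0 r \ {r})) := by
  induction Φ generalizing r with
  | nil =>
    have h := theta_C_mul_X_pow α 0 0 1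
    rw [Polynomial.C_1, pow_zero, one_mul, one_mul, if_pos le_rfl, hα] at h
    rw [factorProd, vertexOp_apply, map_one, h, vertexEigenvalue, one_smul, sub_self]
    exact Submodule.zero_mem _
  | cons φ Φ ih =>
    have hΦ' : ∀ φ ∈ Φ, Factor.Compatible φ α B := fun φ hφ => hΦ φ (by simp [hφ])
    have hr' : ∀ i, Φ.length ≤ i → r (i + 1) = 0 := fun i hi => hr _ (by simpa using hi)
    have hφ := hΦ φ (by simp)
    have hne : ∀ {b d : ℕ} {r' : ℕ → ℕ}, r' ∈ dominating Φ.length d (fun i => r (i + 1)) →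
        b = r 0 + d → 0 < d → consSeq b r' ∈ dominating (Φ.length + 1) 0 r \ {r} := by
      intro b d r' h hb hd
      refine ⟨consSeq_mem_dominating h (by omega), fun h2 => ?_⟩
      have := congrFun h2 0
      simp only [consSeq] at this
      omega
    rw [factorProd, vertexOp_apply, map_mul, theta_shift_mul hφ, vertexEigenvalue]
    set h := factorProd Φ fun i => r (i + 1)
    have hres : residue φ 0 (r 0) (B h) - φ.p ^ r 0 • (φ.seq (r 0) * h) ∈
        Submodule.span K (factorProd (φ :: Φ) '' (dominating (Φ.length + 1) 0 r \ {r})) := by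
      have h1 : residue φ 0 (r 0) (B h) = φ.p ^ r 0 • (φ.seq (r 0) * h) +
          ∑ l ∈ (B h).support.erase 0, ((φ.s ^ l)⁻¹ * φ.s ^ 0 * φ.p ^ (r 0 + l - 0)) •
            (φ.seq (r 0 + l - 0) * (B h).coeff l) := by
        rw [residue_apply]
        simp only [zero_le, if_true]
        by_cases h0 : 0 ∈ (B h).support
        · rw [← Finset.add_sum_erase _ _ h0]
          simp [hB]
        · rw [Finset.erase_eq_of_notMem h0]
          rw [Polynomial.notMem_support_iff, hB] at h0
          simp [h0]
      rw [h1, add_sub_cancel_left]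
      refine Submodule.sum_mem _ fun l hl => Submodule.smul_mem _ _ ?_
      have hl : l ≠ 0 := (Finset.mem_erase.1 hl).1
      exact seq_mul_mem_span (fun r' h => hne h rfl (by omega)) (coeff_shift_mem_span hΦ' _ hr' l)
    have hsum : ∑ j ∈ Finset.range (B h).natDegree, (φ.s ^ (j + 1))⁻¹ •
        (φ.seq (r 0 + j + 1) * theta α (0 + j + 1) (B h)) ∈
        Submodule.span K (factorProd (φ :: Φ) '' (dominating (Φ.length + 1) 0 r \ {r})) := by
      refine Submodule.sum_mem _ fun j _ => Submodule.smul_mem _ _ ?_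
      exact seq_mul_mem_span (fun r' h => hne h (by omega) (by omega))
        (vertexOp_mem_span hα hΦ' _ hr' (0 + j + 1))
    have htail : φ.seq (r 0) * (theta α 0 (B h) - vertexEigenvalue Φ (fun i => r (i + 1)) • h) ∈
        Submodule.span K (factorProd (φ :: Φ) '' (dominating (Φ.length + 1) 0 r \ {r})) := by
      refine seq_mul_mem_span ?_ (ih hΦ' _ hr')
      refine fun r' h => ⟨consSeq_mem_dominating h.1 rfl, fun h2 => h.2 ?_⟩
      funext i
      exact congrFun h2 (i + 1)
    have := Submodule.sub_mem _ (Submodule.add_mem _ (Submodule.smul_mem _ φ.c htail)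
      (Submodule.smul_mem _ (1 - φ.c) hres)) (Submodule.smul_mem _ (1 - φ.c) hsum)
    refine cast (congrArg (· ∈ _) ?_) this
    simp only [Algebra.smul_def, map_mul, map_add, map_sub, map_one]
    ring

end Triangular

open MvPowerSeries

/-! ### The ring of symmetric functions as a polynomial ring in the power sums -/

section PowerHom

variable (K : Type*) [Field K]

/-- The homomorphism sending the generator `X k` to the power sum of degree `k + 1`. -/
def powerHom : MvPolynomial ℕ K →ₐ[K] SymFun K := MvPolynomial.aeval fun k => psum K (k + 1)

lemma powerHom_X (k : ℕ) : powerHom K (MvPolynomial.X k) = psum K (k + 1) := by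
  simp [powerHom]

lemma exists_diagram (s : Multiset ℕ) :
    ∃ lam : YoungDiagram, (lam.rowLens : Multiset ℕ) = s.map Nat.succ := by
  have hs : ((s.map Nat.succ).sort (· ≥ ·)).SortedGE :=
    ((s.map Nat.succ).pairwise_sort _).sortedGE
  refine ⟨YoungDiagram.ofRowLens _ hs, ?_⟩
  rw [YoungDiagram.rowLens_ofRowLens_eq_self, Multiset.sort_eq]
  intro x hx
  rw [Multiset.mem_sort] at hx
  obtain ⟨i, -, rfl⟩ := Multiset.mem_map.1 hx
  exact i.succ_pos

/-- The partition with `a k` parts equal to `k + 1`. -/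
def cycleDiagram (a : ℕ →₀ ℕ) : YoungDiagram := (exists_diagram (Finsupp.toMultiset a)).choose

lemma rowLens_cycleDiagram (a : ℕ →₀ ℕ) :
    ((cycleDiagram a).rowLens : Multiset ℕ) = (Finsupp.toMultiset a).map Nat.succ :=
  (exists_diagram (Finsupp.toMultiset a)).choose_spec

lemma cycleDiagram_bijective : Function.Bijective cycleDiagram := by
  refine ⟨fun a b h => ?_, fun lam => ?_⟩
  · have h1 := congrArg (fun lam : YoungDiagram => (lam.rowLens : Multiset ℕ)) h
    simp only [rowLens_cycleDiagram] at h1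
    have h2 := congrArg Multiset.toFinsupp (Multiset.map_injective Nat.succ_injective h1)
    rwa [Finsupp.toMultiset_toFinsupp, Finsupp.toMultiset_toFinsupp] at h2
  · refine ⟨Multiset.toFinsupp ((lam.rowLens : Multiset ℕ).map Nat.pred),
      rowLens_coe_injective ?_⟩
    rw [rowLens_cycleDiagram, Multiset.toFinsupp_toMultiset, Multiset.map_map]
    conv_rhs => rw [← Multiset.map_id (lam.rowLens : Multiset ℕ)]
    refine Multiset.map_congr rfl fun x hx => ?_
    exact Nat.succ_pred_eq_of_pos (lam.pos_of_mem_rowLens x hx)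

lemma prod_map_rowLens_cycleDiagram {A : Type*} [CommMonoid A] (f : ℕ → A) (a : ℕ →₀ ℕ) :
    ((cycleDiagram a).rowLens.map f).prod = a.prod fun k m => f (k + 1) ^ m := by
  rw [← Multiset.prod_coe, ← Multiset.map_coe, rowLens_cycleDiagram, Multiset.map_map,
    Finset.prod_multiset_map_count, Finsupp.toFinset_toMultiset, Finsupp.prod]
  refine Finset.prod_congr rfl fun k _ => ?_
  rw [Finsupp.count_toMultiset]
  rfl

lemma powerHom_monomial (a : ℕ →₀ ℕ) :
    powerHom K (MvPolynomial.monomial a 1) = psumPart K (cycleDiagram a) := by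
  rw [psumPart, prod_map_rowLens_cycleDiagram, powerHom, MvPolynomial.aeval_monomial, map_one,
    one_mul]

lemma zPart_cycleDiagram (a : ℕ →₀ ℕ) :
    zPart (cycleDiagram a) = a.prod fun k m => (k + 1) ^ m * m.factorial := by
  have h1 : (cycleDiagram a).rowLens.toFinset =
      ((cycleDiagram a).rowLens : Multiset ℕ).toFinset := rfl
  have h2 : ∀ i, (cycleDiagram a).rowLens.count i =
      ((cycleDiagram a).rowLens : Multiset ℕ).count i := fun i => (Multiset.coe_count _ _).symm
  rw [zPart, h1]
  simp only [h2]
  rw [rowLens_cycleDiagram, Multiset.toFinset_map, Finsupp.toFinset_toMultiset,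
    Finset.prod_image Nat.succ_injective.injOn, Finsupp.prod]
  refine Finset.prod_congr rfl fun k _ => ?_
  rw [Multiset.count_map_eq_count' _ _ Nat.succ_injective, Finsupp.count_toMultiset]

variable [CharZero K]

lemma powerHom_bijective : Function.Bijective (powerHom K) := by
  let e : MvPolynomial ℕ K ≃ₗ[K] SymFun K := (MvPolynomial.basisMonomials ℕ K).equiv
    (psumBasis K) (Equiv.ofBijective _ cycleDiagram_bijective)
  have h : (powerHom K).toLinearMap = e.toLinearMap := by
    refine (MvPolynomial.basisMonomials ℕ K).ext fun a => ?_
    simp only [MvPolynomial.coe_basisMonomials, AlgHom.toLinearMap_apply, powerHom_monomial]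
    have := (MvPolynomial.basisMonomials ℕ K).equiv_apply a (psumBasis K)
      (Equiv.ofBijective _ cycleDiagram_bijective)
    rw [psumBasis_apply, MvPolynomial.coe_basisMonomials] at this
    exact this.symm
  have h2 : ⇑(powerHom K) = e := by
    funext x
    exact LinearMap.congr_fun h x
  rw [h2]
  exact e.bijective

/-- The ring of symmetric functions is the polynomial ring in the power sums. -/
def powerEquiv : MvPolynomial ℕ K ≃ₐ[K] SymFun K :=
  AlgEquiv.ofBijective (powerHom K) (powerHom_bijective K)

variable {K} (q t : K)

/-- The norm of the power sum of degree `k + 1`. -/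
def powerNorm (k : ℕ) : K := ((k : K) + 1) * ((1 - q ^ (k + 1)) / (1 - t ^ (k + 1)))

/-- The Hall scalar product on polynomials in the power sums. -/
def powerForm : LinearMap.BilinForm K (MvPolynomial ℕ K) :=
  (hall q t).compl₁₂ (powerHom K).toLinearMap (powerHom K).toLinearMap

lemma powerForm_apply (u v : MvPolynomial ℕ K) :
    powerForm q t u v = hall q t (powerHom K u) (powerHom K v) := rfl

lemma powerForm_monomial (a b : ℕ →₀ ℕ) [Decidable (a = b)] :
    powerForm q t (MvPolynomial.monomial a 1) (MvPolynomial.monomial b 1) =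
      if a = b then a.prod fun k m => powerNorm q t k ^ m * (m.factorial : K) else 0 := by
  classical
  rw [powerForm_apply, powerHom_monomial, powerHom_monomial, hall_psumPart]
  simp only [cycleDiagram_bijective.1.eq_iff]
  split_ifs
  · rw [prod_map_rowLens_cycleDiagram, zPart_cycleDiagram, Finsupp.prod, Finsupp.prod,
      Finsupp.prod, Nat.cast_prod, ← Finset.prod_mul_distrib]
    refine Finset.prod_congr rfl fun k _ => ?_
    rw [powerNorm, mul_pow]
    push_cast
    ring
  · rfl

lemma powerForm_comm (u v : MvPolynomial ℕ K) : powerForm q t u v = powerForm q t v u := by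
  classical
  have h : powerForm q t = LinearMap.flip (powerForm q t) := by
    refine (MvPolynomial.basisMonomials ℕ K).ext fun a => (MvPolynomial.basisMonomials ℕ K).ext
      fun b => ?_
    simp only [MvPolynomial.coe_basisMonomials, LinearMap.flip_apply, powerForm_monomial]
    by_cases hab : a = b
    · rw [hab]
    · rw [if_neg hab, if_neg (Ne.symm hab)]
  exact LinearMap.congr_fun (LinearMap.congr_fun h u) v

/-- On monomials: raising the exponent of `X k` by one multiplies the norm by `powerNorm q t k`
times the new exponent, and that exponent is what the derivative produces. -/
lemma powerForm_X_mul (k : ℕ) (u v : MvPolynomial ℕ K) :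
    powerForm q t (MvPolynomial.X k * u) v =
      powerNorm q t k * powerForm q t u (MvPolynomial.pderiv k v) := by
  classical
  have h : powerForm q t ∘ₗ LinearMap.mulLeft K (MvPolynomial.X k) =
      powerNorm q t k • (powerForm q t).compl₂ (MvPolynomial.pderiv k).toLinearMap := by
    refine (MvPolynomial.basisMonomials ℕ K).ext fun a => (MvPolynomial.basisMonomials ℕ K).ext
      fun b => ?_
    simp only [MvPolynomial.coe_basisMonomials, LinearMap.comp_apply, LinearMap.smul_apply,
      LinearMap.compl₂_apply, LinearMap.mulLeft_apply, MvPolynomial.X]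
    rw [MvPolynomial.monomial_mul, one_mul, powerForm_monomial]
    have hd : (MvPolynomial.pderiv k).toLinearMap (MvPolynomial.monomial b (1 : K)) =
        (b k : K) • MvPolynomial.monomial (b - Finsupp.single k 1) 1 := by
      change MvPolynomial.pderiv k _ = _
      rw [MvPolynomial.pderiv_monomial, MvPolynomial.smul_monomial, one_mul, smul_eq_mul, mul_one]
    rw [hd, map_smul, powerForm_monomial]
    by_cases hb : b k = 0
    · rw [if_neg, hb]
      · simp
      · rintro rfl
        simp at hb
    · by_cases hab : Finsupp.single k 1 + a = b
      · subst hab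
        rw [if_pos rfl, if_pos (by rw [add_tsub_cancel_left])]
        rw [← Finsupp.mul_prod_erase' _ k _ (by simp), ← Finsupp.mul_prod_erase' a k _ (by simp)]
        have he : (Finsupp.single k 1 + a).erase k = a.erase k := by
          ext i
          by_cases hi : i = k
          · subst hi
            simp
          · simp [Finsupp.erase_ne hi]
        rw [he]
        simp only [Finsupp.add_apply, Finsupp.single_eq_same, smul_eq_mul, add_comm 1,
          Nat.factorial_succ, pow_succ]
        push_cast
        ring
      · rw [if_neg hab, if_neg, smul_zero, smul_zero]
        rintro rfl
        apply hab
        ext i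
        by_cases hi : i = k
        · subst hi
          simp
          omega
        · simp [Finsupp.single_eq_of_ne hi]
  exact LinearMap.congr_fun (LinearMap.congr_fun h u) v

end PowerHom

/-! ### The generators `g_r`, `e_r` and the Macdonald operator -/

section Operator

variable {K : Type*} [Field K] [CharZero K] (q t : K)

/-- The genericity conditions on the parameters. -/
structure Generic (q t : K) : Prop where
  q_pow : ∀ k : ℕ, 1 - q ^ (k + 1) ≠ 0
  t_pow : ∀ k : ℕ, 1 - t ^ (k + 1) ≠ 0
  t_ne : t ≠ 0
  cells : ∀ S T : Finset (ℕ × ℕ), ∑ x ∈ S, q ^ x.2 * t⁻¹ ^ x.1 = ∑ x ∈ T, q ^ x.2 * t⁻¹ ^ x.1 →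
    S = T

/-- The coefficients of `exp (∑_k c_k p_(k+1) z ^ (k+1) / (k+1))`. -/
abbrev powerExp (c : ℕ → K) (n : ℕ) : MvPolynomial ℕ K :=
  expSeq (fun k => MvPolynomial.C (c k) * MvPolynomial.X k) n

lemma powerExp_mul (c d : ℕ → K) (n : ℕ) :
    ∑ k ∈ Finset.range (n + 1), powerExp c k * powerExp d (n - k) =
      powerExp (fun k => c k + d k) n := by
  rw [← Finset.Nat.sum_antidiagonal_eq_sum_range_succ (fun i j => powerExp c i * powerExp d j),
    sum_expSeq_mul_expSeq]
  congr 1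
  funext k
  rw [map_add, add_mul]

lemma powerExp_scale (s : K) (c : ℕ → K) (n : ℕ) :
    s ^ n • powerExp c n = powerExp (fun k => s ^ (k + 1) * c k) n := by
  rw [MvPolynomial.smul_eq_C_mul, map_pow, expSeq_scale]
  congr 1
  funext k
  rw [map_mul, map_pow, mul_assoc]

/-- The functions `g_r` dual to the monomial symmetric functions. -/
def gFactor : Factor K (MvPolynomial ℕ K) where
  seq := powerExp fun k => (1 - t ^ (k + 1)) / (1 - q ^ (k + 1))
  c := t⁻¹
  s := 1
  p := q

/-- The elementary symmetric functions, up to sign. -/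
def eFactor : Factor K (MvPolynomial ℕ K) where
  seq := powerExp fun _ => -1
  c := q
  s := t⁻¹
  p := t⁻¹

/-- The multiplication part of the Macdonald operator. -/
def macAlpha (n : ℕ) : MvPolynomial ℕ K := powerExp (fun k => -(1 - t ^ (k + 1))) n

/-- The shift part of the Macdonald operator. -/
def macShift : MvPolynomial ℕ K →ₐ[K] Polynomial (MvPolynomial ℕ K) :=
  shiftHom fun k => -(1 - q ^ (k + 1)) * t⁻¹ ^ (k + 1)

/-- The Macdonald operator. -/
def macOp : MvPolynomial ℕ K →ₗ[K] MvPolynomial ℕ K := vertexOp (macAlpha t) (macShift q t) 0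

variable {q t}

/-- Multiplying g(w) by α(w) turns the weight (1 - t^k)/(1 - q^k) into q^k (1 - t^k)/(1 - q^k),
giving g(q w). The shift multiplies g(w) by (1 - t⁻¹ x)/(1 - x) with x = w/z. -/
lemma gFactor_compatible (h : Generic q t) :
    (gFactor q t).Compatible (macAlpha t) (macShift q t) where
  s_ne := one_ne_zero
  fusion a := by
    simp only [gFactor, one_pow, one_smul, macAlpha]
    rw [powerExp_mul, powerExp_scale]
    congr 1
    funext k
    have := h.q_pow k
    field_simp
    ring
  shift a := by
    simp only [gFactor, macShift]
    rw [shiftHom_expSeq]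
    refine Finset.sum_congr rfl fun i _ => ?_
    congr 3
    have h1 : (fun k => (1 - t ^ (k + 1)) / (1 - q ^ (k + 1)) *
        (-(1 - q ^ (k + 1)) * t⁻¹ ^ (k + 1))) = fun k => (1 : K) ^ (k + 1) - t⁻¹ ^ (k + 1) := by
      funext k
      have h1 := h.q_pow k
      have h2 : t ^ (k + 1) * t⁻¹ ^ (k + 1) = 1 := by
        rw [← mul_pow, mul_inv_cancel₀ h.t_ne, one_pow]
      rw [one_pow, div_mul_eq_mul_div, div_eq_iff h1]
      linear_combination (1 - q ^ (k + 1)) * h2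
    rw [h1]
    cases i with
    | zero => simp [expSeq_zero]
    | succ n =>
      rw [expSeq_geom_sub, if_neg (by omega)]
      simp

/-- Multiplying e(w) = exp(-∑ p_k w^k/k) by α(t⁻¹ w) gives e(t⁻¹ w), and the shift multiplies it by
(1 - q x)/(1 - x) with x = t⁻¹ w/z. Compared with g, the values q and t⁻¹ of c and p are
interchanged, so these factors will contribute columns where the g_r contribute rows. -/
lemma eFactor_compatible (h : Generic q t) :
    (eFactor q t).Compatible (macAlpha t) (macShift q t) where
  s_ne := inv_ne_zero h.t_ne
  fusion a := by
    simp only [eFactor, macAlpha, ← smul_mul_assoc]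
    simp only [powerExp_scale]
    rw [powerExp_mul]
    congr 1
    funext k
    have h2 : t⁻¹ ^ (k + 1) * t ^ (k + 1) = 1 := by
      rw [← mul_pow, inv_mul_cancel₀ h.t_ne, one_pow]
    linear_combination h2
  shift a := by
    simp only [eFactor, macShift]
    rw [shiftHom_expSeq]
    refine Finset.sum_congr rfl fun i _ => ?_
    congr 3
    have h1 : (fun k => (-1 : K) * (-(1 - q ^ (k + 1)) * t⁻¹ ^ (k + 1))) =
        fun k => t⁻¹ ^ (k + 1) - (q * t⁻¹) ^ (k + 1) := by
      funext k
      rw [mul_pow]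
      ring
    rw [h1]
    cases i with
    | zero => simp [expSeq_zero]
    | succ n =>
      rw [expSeq_geom_sub, if_neg (by omega)]
      ring

lemma theta_eq_sum_range {R : Type*} [CommRing R] (α : ℕ → R) (Q : Polynomial R) (N : ℕ)
    (hN : Q.natDegree < N) : theta α 0 Q = ∑ l ∈ Finset.range N, α l * Q.coeff l := by
  conv_lhs => rw [Q.as_sum_range_C_mul_X_pow' hN]
  rw [map_sum]
  refine Finset.sum_congr rfl fun l _ => ?_
  rw [theta_C_mul_X_pow, if_pos (Nat.zero_le _), mul_comm, Nat.sub_zero]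

lemma powerForm_macAlpha (h : Generic q t) (n : ℕ) (u v : MvPolynomial ℕ K) :
    powerForm q t (macAlpha t n * u) v =
      t ^ n * powerForm q t u ((macShift q t v).coeff n) := by
  have h1 := expSeq_adjoint (powerForm q t) (w := powerNorm q t)
    (c := fun k => t⁻¹ ^ (k + 1) * -(1 - t ^ (k + 1)))
    (κ := fun k => -(1 - q ^ (k + 1)) * t⁻¹ ^ (k + 1)) (powerForm_X_mul q t) (by
      intro k
      have := h.t_pow k
      rw [powerNorm]
      field_simp) n u v
  rw [macShift, ← h1]
  change _ = t ^ n * powerForm q t (powerExp _ n * u) v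
  rw [← powerExp_scale, smul_mul_assoc, map_smul, LinearMap.smul_apply, smul_eq_mul, ← mul_assoc,
    ← mul_pow, mul_inv_cancel₀ h.t_ne, one_pow, one_mul, macAlpha]

/-- Let B_l be the l-th coefficient of the shift. The operator is ∑ α_l B_l, and multiplication by
α_l is adjoint to t^l B_l, so ⟨E u, v⟩ = ∑ t^l ⟨B_l u, B_l v⟩, which is symmetric. -/
lemma macOp_selfAdjoint (h : Generic q t) (u v : MvPolynomial ℕ K) :
    powerForm q t (macOp q t u) v = powerForm q t u (macOp q t v) := by
  have key : ∀ u v : MvPolynomial ℕ K, ∀ N, (macShift q t u).natDegree < N →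
      powerForm q t (macOp q t u) v = ∑ l ∈ Finset.range N, t ^ l *
        powerForm q t ((macShift q t u).coeff l) ((macShift q t v).coeff l) := by
    intro u v N hN
    rw [macOp, vertexOp_apply, theta_eq_sum_range _ _ N hN, map_sum, LinearMap.sum_apply]
    exact Finset.sum_congr rfl fun l _ => powerForm_macAlpha h l _ _
  set N := max (macShift q t u).natDegree (macShift q t v).natDegree + 1
  rw [powerForm_comm q t u, key u v N (by omega), key v u N (by omega)]
  exact Finset.sum_congr rfl fun l _ => by rw [powerForm_comm]

/-! ### Duality between products of the `g_r` and monomials -/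

/-- The weights of g cancel the norms of the power sums, so the adjoint translation is p_k ↦ p_k +
z^k: adjoin one more variable z and extract the coefficient of z^n. -/
lemma powerForm_gFactor_mul (h : Generic q t) (n : ℕ) (u v : MvPolynomial ℕ K) :
    powerForm q t ((gFactor q t).seq n * u) v =
      powerForm q t u ((shiftHom (fun _ => 1) v).coeff n) := by
  refine expSeq_adjoint (powerForm q t) (w := powerNorm q t) (κ := fun _ => 1)
    (powerForm_X_mul q t) (fun k => ?_) n u v
  have h1 := h.t_pow k
  have h2 := h.q_pow k
  rw [powerNorm]
  field_simp

/-- The product `g_(r 0) ⋯ g_(r (N - 1))`. -/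
abbrev gProd (q t : K) (N : ℕ) (r : ℕ → ℕ) : MvPolynomial ℕ K :=
  factorProd (List.replicate N (gFactor q t)) r

lemma gProd_succ (q t : K) (N : ℕ) (r : ℕ → ℕ) :
    gProd q t (N + 1) r = (gFactor q t).seq (r 0) * gProd q t N fun i => r (i + 1) := rfl

lemma powerForm_gProd_one (h : Generic q t) (N : ℕ) (r : ℕ → ℕ) :
    powerForm q t (gProd q t N r) 1 = if ∀ i < N, r i = 0 then 1 else 0 := by
  classical
  induction N generalizing r with
  | zero =>
    rw [if_pos (by simp)]
    change powerForm q t 1 1 = 1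
    have := powerForm_monomial q t 0 0
    simpa using this
  | succ N ih =>
    rw [gProd_succ, powerForm_gFactor_mul h, map_one, Polynomial.coeff_one]
    by_cases h0 : r 0 = 0
    · rw [if_pos h0, ih]
      refine if_congr ⟨fun h i hi => ?_, fun h i hi => h _ (by omega)⟩ rfl rfl
      cases i with
      | zero => exact h0
      | succ i => exact h i (by omega)
    · rw [if_neg h0, map_zero, if_neg]
      exact fun h => h0 (h 0 (by omega))

lemma powerForm_gProd_mul_X (h : Generic q t) (N : ℕ) (r : ℕ → ℕ) (v : MvPolynomial ℕ K) (k : ℕ) :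
    powerForm q t (gProd q t N r) (v * MvPolynomial.X k) =
      ∑ i ∈ Finset.range N, if k + 1 ≤ r i then
        powerForm q t (gProd q t N (Function.update r i (r i - (k + 1)))) v else 0 := by
  induction N generalizing r v with
  | zero =>
    change powerForm q t 1 _ = _
    rw [powerForm_comm, mul_comm, powerForm_X_mul]
    simp
  | succ N ih =>
    rw [gProd_succ, powerForm_gFactor_mul h, coeff_shiftHom_mul_X, map_add, ih,
      Finset.sum_range_succ']
    congr 1
    · refine Finset.sum_congr rfl fun i _ => ?_
      split_ifs with hi
      · rw [gProd_succ, powerForm_gFactor_mul h, Function.update_of_ne (by omega)]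
        congr 3
        funext j
        by_cases hj : j = i
        · subst hj
          simp
        · rw [Function.update_of_ne hj, Function.update_of_ne (by omega)]
      · rfl
    · split_ifs with hi
      · rw [gProd_succ, powerForm_gFactor_mul h, one_smul, Function.update_self]
        congr 3
      · rw [map_zero]

lemma coeff_psum_mul {R : Type*} [CommRing R] (k : ℕ) (f : MvPowerSeries ℕ R) (a : ℕ →₀ ℕ) (N : ℕ)
    (hN : ∀ i, N ≤ i → a i = 0) :
    coeff a (psumSeries R (k + 1) * f) = ∑ i ∈ Finset.range N,
      if k + 1 ≤ a i then coeff (a - Finsupp.single i (k + 1)) f else 0 := by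
  classical
  rw [coeff_mul, ← Finset.sum_filter]
  have hinj : Set.InjOn (fun i => (Finsupp.single i (k + 1), a - Finsupp.single i (k + 1)))
      (Finset.filter (fun i => k + 1 ≤ a i) (Finset.range N)) := by
    intro i _ j _ hij
    exact Finsupp.single_left_injective k.succ_ne_zero (congrArg Prod.fst hij)
  rw [← Finset.sum_image (g := fun i => (Finsupp.single i (k + 1), a - Finsupp.single i (k + 1)))
    (f := fun x : (ℕ →₀ ℕ) × (ℕ →₀ ℕ) => coeff x.2 f) hinj]
  symm
  refine (Finset.sum_congr rfl fun x hx => ?_).trans (Finset.sum_subset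
    (f := fun x : (ℕ →₀ ℕ) × (ℕ →₀ ℕ) =>
    coeff x.1 (psumSeries R (k + 1)) * coeff x.2 f) (fun x hx => ?_) (fun x hx hx' => ?_))
  · obtain ⟨i, hi, rfl⟩ := Finset.mem_image.1 hx
    rw [coeff_psumSeries, if_pos ⟨i, rfl⟩, one_mul]
  · obtain ⟨i, hi, rfl⟩ := Finset.mem_image.1 hx
    rw [Finset.HasAntidiagonal.mem_antidiagonal]
    refine add_tsub_cancel_of_le (Finsupp.single_le_iff.2 (Finset.mem_filter.1 hi).2)
  · rw [coeff_psumSeries, if_neg, zero_mul]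
    rintro ⟨i, hi⟩
    have h1 := Finset.HasAntidiagonal.mem_antidiagonal.1 hx
    have h2 : k + 1 ≤ a i := by
      rw [← h1, hi]
      simp
    refine hx' (Finset.mem_image.2 ⟨i, Finset.mem_filter.2 ⟨Finset.mem_range.2 ?_, h2⟩, ?_⟩)
    · by_contra h3
      have := hN i (by omega)
      omega
    · rw [← hi, ← h1, add_tsub_cancel_left]

/-- This is the duality between products of the g_r and monomials. Both sides obey the same
recursion under multiplication by a power sum: `coeff_psum_mul` on the left, `powerForm_gProd_mul_X`
on the right. -/
lemma coeff_powerHom (h : Generic q t) (v : MvPolynomial ℕ K) (N : ℕ) :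
    ∀ a : ℕ →₀ ℕ, (∀ i, N ≤ i → a i = 0) →
      coeff a (powerHom K v).1 = powerForm q t (gProd q t N a) v := by
  classical
  induction v using MvPolynomial.induction_on with
  | C c =>
    intro a ha
    have h1 : (MvPolynomial.C c : MvPolynomial ℕ K) = c • 1 := by
      rw [MvPolynomial.smul_eq_C_mul, mul_one]
    rw [h1, map_smul, map_smul, powerForm_gProd_one h, map_one]
    change c * coeff a (1 : MvPowerSeries ℕ K) = _
    rw [coeff_one, smul_eq_mul]
    congr 1
    refine if_congr ⟨fun h i _ => by simp [h], fun h => ?_⟩ rfl rfl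
    ext i
    by_cases hi : i < N
    · exact h i hi
    · exact ha i (by omega)
  | add u v hu hv =>
    intro a ha
    rw [map_add, map_add, ← hu a ha, ← hv a ha]
    rfl
  | mul_X v k hv =>
    intro a ha
    have h1 : (powerHom K (v * MvPolynomial.X k)).1 =
        psumSeries K (k + 1) * (powerHom K v).1 := by
      rw [mul_comm, map_mul, powerHom_X]
      rfl
    rw [h1, coeff_psum_mul k _ a N ha, powerForm_gProd_mul_X h]
    refine Finset.sum_congr rfl fun i _ => ?_
    split_ifs with hi
    · rw [hv _ fun j hj => by simp [ha j hj]]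
      congr 3
      funext j
      by_cases hj : j = i
      · subst hj
        simp
      · simp [Function.update_of_ne hj, Finsupp.single_eq_of_ne hj]
    · rfl

end Operator

/-! ### Partitions and the dominance order -/

section Partitions

lemma rowLen_eq_zero {lam : YoungDiagram} {i : ℕ} (h : lam.colLen 0 ≤ i) : lam.rowLen i = 0 := by
  by_contra h1
  have h2 := YoungDiagram.mem_iff_lt_rowLen.2 (Nat.pos_of_ne_zero h1)
  have := YoungDiagram.mem_iff_lt_colLen.1 h2
  omega

lemma expo_apply (lam : YoungDiagram) (i : ℕ) : expo lam i = lam.rowLen i := rfl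

lemma eq_of_rowLen_eq {lam mu : YoungDiagram} (h : ∀ i, lam.rowLen i = mu.rowLen i) :
    lam = mu := by
  apply YoungDiagram.ext
  ext ⟨i, j⟩
  rw [YoungDiagram.mem_cells, YoungDiagram.mem_cells, YoungDiagram.mem_iff_lt_rowLen,
    YoungDiagram.mem_iff_lt_rowLen, h]

/-- The boxes of the first `n` rows, of lengths `r 0, …, r (n - 1)`, and below them of `m` columns
of lengths `r n, …, r (n + m - 1)`. -/
def hookBoxes (n m : ℕ) (r : ℕ → ℕ) : Finset (ℕ × ℕ) :=
  ((Finset.range n).sigma fun i => Finset.range (r i)).image (fun x => (x.1, x.2)) ∪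
    ((Finset.range m).sigma fun j => Finset.range (r (n + j))).image (fun x => (n + x.2, x.1))

lemma mem_hookBoxes {n m : ℕ} {r : ℕ → ℕ} {i j : ℕ} : (i, j) ∈ hookBoxes n m r ↔
    (i < n ∧ j < r i) ∨ (n ≤ i ∧ j < m ∧ i - n < r (n + j)) := by
  simp only [hookBoxes, Finset.mem_union, Finset.mem_image, Finset.mem_sigma, Finset.mem_range,
    Prod.mk.injEq, Sigma.exists]
  constructor
  · rintro (⟨i, j, h, rfl, rfl⟩ | ⟨j, k, h, rfl, rfl⟩)
    · exact Or.inl h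
    · exact Or.inr ⟨by omega, h.1, by simpa using h.2⟩
  · rintro (h | h)
    · exact Or.inl ⟨i, j, h, rfl, rfl⟩
    · exact Or.inr ⟨j, i - n, ⟨h.2.1, h.2.2⟩, by omega, rfl⟩

lemma sum_hookBoxes {A : Type*} [AddCommMonoid A] (n m : ℕ) (r : ℕ → ℕ) (f : ℕ × ℕ → A) :
    ∑ x ∈ hookBoxes n m r, f x = ∑ i ∈ Finset.range n, ∑ j ∈ Finset.range (r i), f (i, j) +
      ∑ j ∈ Finset.range m, ∑ i ∈ Finset.range (r (n + j)), f (n + i, j) := by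
  rw [hookBoxes, Finset.sum_union, Finset.sum_image, Finset.sum_image, Finset.sum_sigma,
    Finset.sum_sigma]
  · rintro ⟨i, j⟩ _ ⟨i', j'⟩ _ h
    simp only [Prod.mk.injEq] at h
    obtain ⟨h1, rfl⟩ := h
    obtain rfl : j = j' := by omega
    rfl
  · rintro ⟨i, j⟩ _ ⟨i', j'⟩ _ h
    simp only [Prod.mk.injEq] at h
    obtain ⟨rfl, rfl⟩ := h
    rfl
  · rw [Finset.disjoint_left]
    rintro ⟨i, j⟩ h h'
    simp only [Finset.mem_image, Finset.mem_sigma, Finset.mem_range, Prod.mk.injEq,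
      Sigma.exists] at h h'
    obtain ⟨a, b, hab, rfl, rfl⟩ := h
    obtain ⟨c, d, hcd, h1, -⟩ := h'
    omega

lemma cells_eq_hookBoxes (lam : YoungDiagram) {n : ℕ} (hn : lam.colLen 0 ≤ n) :
    lam.cells = hookBoxes n 0 lam.rowLen := by
  ext ⟨i, j⟩
  rw [YoungDiagram.mem_cells, YoungDiagram.mem_iff_lt_rowLen, mem_hookBoxes]
  constructor
  · intro h
    refine Or.inl ⟨?_, h⟩
    by_contra h1
    rw [rowLen_eq_zero (by omega)] at h
    omega
  · rintro (h | h)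
    · exact h.2
    · omega

lemma card_eq_sum_rowLen (lam : YoungDiagram) {n : ℕ} (hn : lam.colLen 0 ≤ n) :
    lam.card = ∑ i ∈ Finset.range n, lam.rowLen i := by
  change lam.cells.card = _
  rw [cells_eq_hookBoxes lam hn, Finset.card_eq_sum_ones, sum_hookBoxes]
  simp

lemma degree_eq_sum_range (d : ℕ →₀ ℕ) {n : ℕ} (hn : ∀ i, n ≤ i → d i = 0) :
    d.degree = ∑ i ∈ Finset.range n, d i := by
  rw [Finsupp.degree_apply]
  refine Finset.sum_subset (fun i hi => Finset.mem_range.2 ?_) fun i _ hi => by simpa using hi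
  by_contra h
  exact (Finsupp.mem_support_iff.1 hi) (hn i (by omega))

lemma degree_expo (lam : YoungDiagram) : (expo lam).degree = lam.card := by
  rw [degree_eq_sum_range _ (fun i hi => rowLen_eq_zero hi), card_eq_sum_rowLen lam le_rfl]
  rfl

lemma colLen_zero_le_card (lam : YoungDiagram) : lam.colLen 0 ≤ lam.card := by
  rw [card_eq_sum_rowLen lam le_rfl]
  calc lam.colLen 0 = ∑ i ∈ Finset.range (lam.colLen 0), 1 := by simp
    _ ≤ _ := Finset.sum_le_sum fun i hi => by
      have := YoungDiagram.mem_iff_lt_colLen.2 (Finset.mem_range.1 hi)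
      exact YoungDiagram.mem_iff_lt_rowLen.1 this

lemma sum_le_sum_range_of_antitone {f : ℕ → ℕ} (hf : Antitone f) (S : Finset ℕ) :
    ∑ i ∈ S, f i ≤ ∑ i ∈ Finset.range S.card, f i := by
  classical
  induction S using Finset.induction_on_max with
  | empty => simp
  | insert a S ha ih =>
    have hn : a ∉ S := fun h => lt_irrefl _ (ha a h)
    rw [Finset.sum_insert hn, Finset.card_insert_of_notMem hn, Finset.sum_range_succ, add_comm]
    refine add_le_add ih (hf ?_)
    calc S.card ≤ (Finset.range a).card :=
          Finset.card_le_card fun x hx => Finset.mem_range.2 (ha x hx)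
      _ = a := Finset.card_range a

lemma antitone_rowLen (lam : YoungDiagram) : Antitone lam.rowLen := fun _ _ h =>
  lam.rowLen_anti _ _ h

/-- Among all rearrangements, the weakly decreasing one has the largest partial sums. -/
lemma sum_range_le_of_antitone {d d' : ℕ →₀ ℕ} (hd : expParts d = expParts d')
    (hd' : Antitone d') (j : ℕ) : ∑ i ∈ Finset.range j, d i ≤ ∑ i ∈ Finset.range j, d' i := by
  obtain ⟨e, rfl⟩ := exists_perm_of_expParts_eq hd
  have h1 : ∀ i, d'.mapDomain e i = d' (e.symm i) := by
    intro i
    conv_lhs => rw [← e.apply_symm_apply i]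
    rw [Finsupp.mapDomain_apply e.injective]
  simp only [h1]
  have h2 := sum_le_sum_range_of_antitone hd' ((Finset.range j).map e.symm.toEmbedding)
  rw [Finset.sum_map, Finset.card_map, Finset.card_range] at h2
  exact h2

lemma sum_range_le_of_expParts {lam : YoungDiagram} {d : ℕ →₀ ℕ}
    (hd : expParts d = (lam.rowLens : Multiset ℕ)) (j : ℕ) :
    ∑ i ∈ Finset.range j, d i ≤ ∑ i ∈ Finset.range j, lam.rowLen i :=
  sum_range_le_of_antitone (d' := expo lam) (hd.trans (expParts_expo lam).symm)
    (antitone_rowLen lam) j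

/-- `mu < lam` in the dominance order. -/
def StrictlyDominated (mu lam : YoungDiagram) : Prop := DominatedBy mu lam ∧ mu ≠ lam

/-- A strictly monotone function for the dominance order. -/
def dominanceRank (lam : YoungDiagram) : ℕ :=
  ∑ k ∈ Finset.range (lam.card + 1), ∑ i ∈ Finset.range k, lam.rowLen i

lemma eq_of_sum_range_eq {r r' : ℕ → ℕ}
    (h : ∀ k, ∑ i ∈ Finset.range k, r i = ∑ i ∈ Finset.range k, r' i) : r = r' := by
  funext i
  have h1 := h i
  have h2 := h (i + 1)
  rw [Finset.sum_range_succ, Finset.sum_range_succ] at h2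
  omega

lemma DominatedBy.refl (lam : YoungDiagram) : DominatedBy lam lam := ⟨rfl, fun _ => le_rfl⟩

lemma DominatedBy.trans {lam mu nu : YoungDiagram} (h : DominatedBy lam mu)
    (h' : DominatedBy mu nu) : DominatedBy lam nu :=
  ⟨h.1.trans h'.1, fun k => (h.2 k).trans (h'.2 k)⟩

lemma DominatedBy.antisymm {lam mu : YoungDiagram} (h : DominatedBy lam mu)
    (h' : DominatedBy mu lam) : lam = mu :=
  eq_of_rowLen_eq (congrFun (eq_of_sum_range_eq fun k => le_antisymm (h.2 k) (h'.2 k)))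

lemma StrictlyDominated.trans_left {lam mu nu : YoungDiagram} (h : DominatedBy lam mu)
    (h' : StrictlyDominated mu nu) : StrictlyDominated lam nu := by
  refine ⟨h.trans h'.1, ?_⟩
  rintro rfl
  exact h'.2 (h'.1.antisymm h)

lemma StrictlyDominated.rank_lt {lam mu : YoungDiagram} (h : StrictlyDominated lam mu) :
    dominanceRank lam < dominanceRank mu := by
  rw [dominanceRank, dominanceRank, h.1.1]
  refine Finset.sum_lt_sum (fun k _ => h.1.2 k) ?_
  by_contra hcon
  push Not at hcon
  refine h.2 (h.1.antisymm ⟨h.1.1.symm, fun k => ?_⟩)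
  by_cases hk : k < mu.card + 1
  · exact hcon k (Finset.mem_range.2 hk)
  -- Past the common size, both partial sums have reached it.
  · have h1 := colLen_zero_le_card mu
    have h2 := colLen_zero_le_card lam
    have h3 := h.1.1
    rw [← card_eq_sum_rowLen mu (by omega), ← card_eq_sum_rowLen lam (by omega), h3]

/-- Dominated partitions are at least as long. -/
lemma DominatedBy.colLen_le {mu lam : YoungDiagram} (h : DominatedBy mu lam) :
    lam.colLen 0 ≤ mu.colLen 0 := by
  by_contra hlt
  have h1 := h.2 (mu.colLen 0)
  rw [← card_eq_sum_rowLen mu le_rfl, h.1] at h1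
  have h2 := card_eq_sum_rowLen lam (n := mu.colLen 0 + 1 + (lam.colLen 0 - (mu.colLen 0 + 1)))
    (by omega)
  rw [Finset.sum_range_add, Finset.sum_range_succ] at h2
  have h3 := YoungDiagram.mem_iff_lt_rowLen.1
    (YoungDiagram.mem_iff_lt_colLen.2 (not_le.1 hlt))
  omega

/-- Dominated partitions have a smaller first part. -/
lemma DominatedBy.rowLen_le {mu lam : YoungDiagram} (h : DominatedBy mu lam) :
    mu.rowLen 0 ≤ lam.rowLen 0 := by
  simpa using h.2 1

end Partitions

/-! ### The Macdonald operator on symmetric functions -/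

section SymOp

variable {K : Type*} [Field K] [CharZero K] {q t : K}

/-- The Macdonald operator on the ring of symmetric functions. -/
def symOp (q t : K) : SymFun K →ₗ[K] SymFun K :=
  (powerHom K).toLinearMap ∘ₗ macOp q t ∘ₗ (powerEquiv K).symm.toLinearMap

lemma symOp_powerHom (u : MvPolynomial ℕ K) :
    symOp q t (powerHom K u) = powerHom K (macOp q t u) := by
  change powerHom K (macOp q t ((powerEquiv K).symm (powerEquiv K u))) = _
  rw [AlgEquiv.symm_apply_apply]

lemma exists_powerHom_eq (f : SymFun K) : ∃ u, powerHom K u = f := (powerHom_bijective K).2 f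

lemma hall_comm (f g : SymFun K) : hall q t f g = hall q t g f := by
  obtain ⟨u, rfl⟩ := exists_powerHom_eq f
  obtain ⟨v, rfl⟩ := exists_powerHom_eq g
  exact powerForm_comm q t u v

lemma hall_symOp (h : Generic q t) (f g : SymFun K) :
    hall q t (symOp q t f) g = hall q t f (symOp q t g) := by
  obtain ⟨u, rfl⟩ := exists_powerHom_eq f
  obtain ⟨v, rfl⟩ := exists_powerHom_eq g
  rw [symOp_powerHom, symOp_powerHom]
  exact macOp_selfAdjoint h u v

/-- Products of `n` of the `g_r` and `m` of the `e_r`. -/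
def hookProd (q t : K) (n m : ℕ) (r : ℕ → ℕ) : SymFun K :=
  powerHom K (factorProd (List.replicate n (gFactor q t) ++ List.replicate m (eFactor q t)) r)

lemma hall_hookProd (h : Generic q t) (n : ℕ) (a : ℕ →₀ ℕ) (ha : ∀ i, n ≤ i → a i = 0)
    (f : SymFun K) : hall q t (hookProd q t n 0 a) f = coeff a f.1 := by
  obtain ⟨u, rfl⟩ := exists_powerHom_eq f
  rw [coeff_powerHom h u n a ha, hookProd, List.replicate_zero, List.append_nil]
  rfl

/-- The eigenvalue of the Macdonald operator for a set of boxes. -/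
def boxEigenvalue (q t : K) (S : Finset (ℕ × ℕ)) : K :=
  1 - (1 - t⁻¹) * (1 - q) * ∑ x ∈ S, q ^ x.2 * t⁻¹ ^ x.1

omit [CharZero K] in
lemma boxEigenvalue_injective (h : Generic q t) : Function.Injective (boxEigenvalue q t) := by
  intro S T hST
  refine h.cells S T ?_
  have h1 : (1 - t⁻¹) * (1 - q) ≠ 0 := by
    refine mul_ne_zero ?_ (by simpa using h.q_pow 0)
    intro h2
    have h3 := h.t_pow 0
    rw [zero_add, pow_one] at h3
    have h4 : t⁻¹ = 1 := (sub_eq_zero.1 h2).symm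
    rw [inv_eq_one] at h4
    exact h3 (by rw [h4, sub_self])
  exact mul_left_cancel₀ h1 (sub_right_injective hST)

lemma vertexEigenvalue_eFactor (m : ℕ) (r : ℕ → ℕ) :
    vertexEigenvalue (List.replicate m (eFactor q t)) r = 1 - (1 - t⁻¹) * (1 - q) *
      ∑ j ∈ Finset.range m, ∑ i ∈ Finset.range (r j), q ^ j * t⁻¹ ^ i := by
  induction m generalizing r with
  | zero => simp [vertexEigenvalue]
  | succ m ih =>
    rw [List.replicate_succ, vertexEigenvalue, ih, Finset.sum_range_succ' _ m]
    have h1 := mul_neg_geom_sum t⁻¹ (r 0)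
    have h2 : ∑ j ∈ Finset.range m, ∑ i ∈ Finset.range (r (j + 1)), q ^ (j + 1) * t⁻¹ ^ i =
        q * ∑ j ∈ Finset.range m, ∑ i ∈ Finset.range (r (j + 1)), q ^ j * t⁻¹ ^ i := by
      simp only [Finset.mul_sum]
      refine Finset.sum_congr rfl fun j _ => Finset.sum_congr rfl fun i _ => ?_
      ring
    rw [h2]
    simp only [eFactor, pow_zero, one_mul]
    linear_combination (1 - q) * h1

/-- Since q^a = 1 - (1 - q)(1 + q + ⋯ + q^(a-1)), a factor g_a contributes a row of a boxes, and its
c = t⁻¹ moves everything after it one row down. In the same way a factor e_a contributes a column,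
and its c = q moves the later columns one step to the right. -/
lemma vertexEigenvalue_hook (n m : ℕ) (r : ℕ → ℕ) :
    vertexEigenvalue (List.replicate n (gFactor q t) ++ List.replicate m (eFactor q t)) r =
      boxEigenvalue q t (hookBoxes n m r) := by
  rw [boxEigenvalue, sum_hookBoxes]
  induction n generalizing r with
  | zero =>
    rw [List.replicate_zero, List.nil_append, vertexEigenvalue_eFactor]
    simp
  | succ n ih =>
    rw [List.replicate_succ, List.cons_append, vertexEigenvalue, ih, Finset.sum_range_succ' _ n]
    have h1 := mul_neg_geom_sum q (r 0)
    have h2 : ∑ i ∈ Finset.range n, ∑ j ∈ Finset.range (r (i + 1)), q ^ j * t⁻¹ ^ (i + 1) =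
        t⁻¹ * ∑ i ∈ Finset.range n, ∑ j ∈ Finset.range (r (i + 1)), q ^ j * t⁻¹ ^ i := by
      simp only [Finset.mul_sum]
      refine Finset.sum_congr rfl fun j _ => Finset.sum_congr rfl fun i _ => ?_
      ring
    have h3 : ∑ j ∈ Finset.range m, ∑ i ∈ Finset.range (r (n + 1 + j)),
        q ^ j * t⁻¹ ^ (n + 1 + i) =
        t⁻¹ * ∑ j ∈ Finset.range m, ∑ i ∈ Finset.range (r (n + j + 1)),
          q ^ j * t⁻¹ ^ (n + i) := by
      simp only [Finset.mul_sum]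
      refine Finset.sum_congr rfl fun j _ => ?_
      rw [show n + 1 + j = n + j + 1 by ring]
      refine Finset.sum_congr rfl fun i _ => ?_
      ring
    rw [h2, h3]
    simp only [gFactor, pow_zero, mul_one]
    linear_combination (1 - t⁻¹) * h1

lemma symOp_hookProd (h : Generic q t) (n m : ℕ) (r : ℕ → ℕ) (hr : ∀ i, n + m ≤ i → r i = 0) :
    symOp q t (hookProd q t n m r) - boxEigenvalue q t (hookBoxes n m r) • hookProd q t n m r ∈
      Submodule.span K (hookProd q t n m '' (dominating (n + m) 0 r \ {r})) := by
  have h1 := vertexOp_sub_mem_span (Φ := List.replicate n (gFactor q t) ++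
    List.replicate m (eFactor q t)) (α := macAlpha t) (B := macShift q t) (by
      rw [macAlpha, powerExp, expSeq_zero]) (coeff_zero_shiftHom _) (by
      intro φ hφ
      rcases List.mem_append.1 hφ with hφ | hφ
      · rw [List.eq_of_mem_replicate hφ]
        exact gFactor_compatible h
      · rw [List.eq_of_mem_replicate hφ]
        exact eFactor_compatible h) r (by simpa using hr)
  have h2 := Submodule.mem_map_of_mem (f := (powerHom K).toLinearMap) h1
  rw [Submodule.map_span, ← Set.image_comp, vertexEigenvalue_hook] at h2
  simp only [List.length_append, List.length_replicate] at h2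
  rw [map_sub, map_smul] at h2
  have h3 : symOp q t (hookProd q t n m r) = (powerHom K).toLinearMap (vertexOp (macAlpha t)
      (macShift q t) 0 (factorProd (List.replicate n (gFactor q t) ++
        List.replicate m (eFactor q t)) r)) := symOp_powerHom _
  rw [h3]
  exact h2

lemma exists_finsupp_eq {N : ℕ} {r : ℕ → ℕ} (hr : ∀ i, N ≤ i → r i = 0) :
    ∃ a : ℕ →₀ ℕ, ⇑a = r :=
  ⟨Finsupp.onFinset (Finset.range N) r fun i hi => Finset.mem_range.2 (by
    by_contra h
    exact hi (hr i (by omega))), rfl⟩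

lemma dominatedBy_of_dominating {kap mu : YoungDiagram} {a : ℕ →₀ ℕ}
    (ha : ⇑a ∈ dominating (kap.colLen 0) 0 kap.rowLen)
    (hmu : expParts a = (mu.rowLens : Multiset ℕ)) : DominatedBy kap mu := by
  refine ⟨?_, fun k => ?_⟩
  · rw [card_eq_sum_rowLen kap le_rfl, ← ha.2.1, add_zero, ← degree_eq_sum_range a ha.1,
      degree_eq_expParts, hmu, ← expParts_expo, ← degree_eq_expParts, degree_expo]
  · have := ha.2.2 k
    have := sum_range_le_of_expParts hmu k
    omega

/-! ### Triangularity on monomial symmetric functions and existence of Macdonald polynomials -/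

/-- The span of the `m_mu` with `mu < lam`. -/
def lowerSpan (K : Type*) [Field K] (lam : YoungDiagram) : Submodule K (SymFun K) :=
  Submodule.span K (msym K '' {mu | StrictlyDominated mu lam})

/-- The eigenvalue of the Macdonald operator at `P_lam`. -/
abbrev macEigenvalue (q t : K) (lam : YoungDiagram) : K := boxEigenvalue q t lam.cells

/-- The coefficient of E m_mu at kap is ⟨g_kap, E m_mu⟩ = ⟨E g_kap, m_mu⟩. Apart from its diagonal
term, E g_kap involves only g_r with r ≠ kap dominating kap, and such a g_r pairs nontrivially with
m_mu only if r is a rearrangement of mu. -/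
lemma coeff_symOp_msym (h : Generic q t) (kap mu : YoungDiagram)
    (hne : coeff (expo kap) (symOp q t (msym K mu)).1 ≠
      macEigenvalue q t kap * coeff (expo kap) (msym K mu).1) : StrictlyDominated kap mu := by
  classical
  by_contra hcon
  apply hne
  rw [← hall_hookProd h (kap.colLen 0) (expo kap) (fun i hi => rowLen_eq_zero hi), ← hall_symOp h]
  have h1 := symOp_hookProd h (kap.colLen 0) 0 (expo kap) (fun i hi => rowLen_eq_zero hi)
  have h2 : hookBoxes (kap.colLen 0) 0 (expo kap) = kap.cells :=
    (cells_eq_hookBoxes kap le_rfl).symm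
  rw [h2, add_zero] at h1
  set y := symOp q t (hookProd q t (kap.colLen 0) 0 (expo kap)) -
    boxEigenvalue q t kap.cells • hookProd q t (kap.colLen 0) 0 (expo kap) with hy
  have h3 : hall q t y (msym K mu) = 0 := by
    clear_value y
    clear hy
    induction h1 using Submodule.span_induction with
    | mem x hx =>
      obtain ⟨r, ⟨hr, hr'⟩, rfl⟩ := hx
      obtain ⟨a, rfl⟩ := exists_finsupp_eq hr.1
      rw [hall_hookProd h _ _ hr.1, coeff_msym, if_neg]
      intro ha
      have hdom := dominatedBy_of_dominating hr ha
      by_cases hkm : kap = mu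
      · subst hkm
        -- A rearrangement of kap has partial sums at most those of kap, so dominating kap forces
        -- equality, which was excluded.
        apply hr'
        refine eq_of_sum_range_eq fun k => le_antisymm ?_ (by simpa using hr.2.2 k)
        exact sum_range_le_of_expParts ha k
      · exact hcon ⟨hdom, hkm⟩
    | zero => simp
    | add x y _ _ hx hy => rw [map_add, LinearMap.add_apply, hx, hy, add_zero]
    | smul c x _ hx => rw [map_smul, LinearMap.smul_apply, hx, smul_zero]
  rw [hy, map_sub, map_smul, LinearMap.sub_apply, LinearMap.smul_apply, sub_eq_zero] at h3
  rw [h3, hall_hookProd h _ _ (fun i hi => rowLen_eq_zero hi), smul_eq_mul]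

omit [CharZero K] in
lemma coeff_expo_msym (kap mu : YoungDiagram) [Decidable (kap = mu)] :
    coeff (expo kap) (msym K mu).1 = if kap = mu then 1 else 0 := by
  classical
  rw [coeff_msym]
  refine if_congr ⟨fun h => ?_, fun h => by rw [h, expParts_expo]⟩ rfl rfl
  rw [expParts_expo] at h
  exact rowLens_coe_injective h

omit [CharZero K] in
lemma mem_span_msym_of_coeff {f : SymFun K} {S : Set YoungDiagram}
    (hS : ∀ lam, coeff (expo lam) f.1 ≠ 0 → lam ∈ S) : f ∈ Submodule.span K (msym K '' S) := by
  obtain ⟨T, hT, hf⟩ := eq_sum_msym f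
  rw [hf]
  exact Submodule.sum_mem _ fun lam hl => Submodule.smul_mem _ _
    (Submodule.subset_span ⟨lam, hS lam (hT lam hl), rfl⟩)

lemma symOp_msym (h : Generic q t) (mu : YoungDiagram) :
    symOp q t (msym K mu) - macEigenvalue q t mu • msym K mu ∈ lowerSpan K mu := by
  classical
  refine mem_span_msym_of_coeff fun kap hk => ?_
  refine coeff_symOp_msym h kap mu fun h1 => hk ?_
  change coeff (expo kap) (symOp q t (msym K mu)).1 -
    macEigenvalue q t mu * coeff (expo kap) (msym K mu).1 = 0
  rw [h1, coeff_expo_msym]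
  by_cases hkm : kap = mu
  · rw [hkm, sub_self]
  · rw [if_neg hkm, mul_zero, mul_zero, sub_self]

omit [CharZero K] in
lemma lowerSpan_le {mu lam : YoungDiagram} (h : DominatedBy mu lam) :
    lowerSpan K mu ≤ lowerSpan K lam := by
  refine Submodule.span_mono (Set.image_mono fun kap hk => ⟨hk.1.trans h, ?_⟩)
  rintro rfl
  exact hk.2 (hk.1.antisymm h)

lemma symOp_lowerSpan (h : Generic q t) {lam : YoungDiagram} {x : SymFun K}
    (hx : x ∈ lowerSpan K lam) : symOp q t x ∈ lowerSpan K lam := by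
  induction hx using Submodule.span_induction with
  | mem x hx =>
    obtain ⟨mu, hmu, rfl⟩ := hx
    rw [← sub_add_cancel (symOp q t (msym K mu)) (macEigenvalue q t mu • msym K mu)]
    exact Submodule.add_mem _ (lowerSpan_le hmu.1 (symOp_msym h mu))
      (Submodule.smul_mem _ _ (Submodule.subset_span ⟨mu, hmu, rfl⟩))
  | zero => rw [map_zero]; exact Submodule.zero_mem _
  | add x y _ _ hx hy => rw [map_add]; exact Submodule.add_mem _ hx hy
  | smul c x _ hx => rw [map_smul]; exact Submodule.smul_mem _ _ hx

omit [CharZero K] in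
lemma macEigenvalue_injective (h : Generic q t) : Function.Injective (macEigenvalue q t) :=
  fun _ _ hlm => YoungDiagram.ext (boxEigenvalue_injective h hlm)

/-- On the m_kap with kap < lam, the operator E minus its eigenvalue at lam is triangular with
nonzero diagonal entries, hence surjective. The induction goes up the dominance order. -/
lemma lowerSpan_le_map (h : Generic q t) (lam : YoungDiagram) :
    lowerSpan K lam ≤ (lowerSpan K lam).map
      (symOp q t - macEigenvalue q t lam • LinearMap.id) := by
  refine Submodule.span_le.2 ?_
  rintro _ ⟨kap, hk, rfl⟩
  induction hn : dominanceRank kap using Nat.strong_induction_on generalizing kap with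
  | _ n ih =>
    have hne : macEigenvalue q t kap - macEigenvalue q t lam ≠ 0 :=
      sub_ne_zero.2 fun h1 => hk.2 (macEigenvalue_injective h h1)
    have h1 : lowerSpan K kap ≤ (lowerSpan K lam).map
        (symOp q t - macEigenvalue q t lam • LinearMap.id) := by
      refine Submodule.span_le.2 ?_
      rintro _ ⟨rho, hr, rfl⟩
      exact ih _ (hn ▸ hr.rank_lt) rho (StrictlyDominated.trans_left hr.1 hk) rfl
    have h2 := h1 (symOp_msym h kap)
    have h3 : symOp q t (msym K kap) - macEigenvalue q t lam • msym K kap ∈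
        (lowerSpan K lam).map (symOp q t - macEigenvalue q t lam • LinearMap.id) :=
      ⟨msym K kap, Submodule.subset_span ⟨kap, hk, rfl⟩, rfl⟩
    rw [SetLike.mem_coe, ← Submodule.smul_mem_iff _ hne]
    have h4 := Submodule.sub_mem _ h3 h2
    rwa [sub_sub_sub_cancel_left, ← sub_smul] at h4

/-- Surjectivity on the lower span lets m_lam be corrected by smaller terms to an eigenvector.
Distinct eigenvalues of a self-adjoint operator give orthogonality. -/
lemma exists_macdonaldFamily (h : Generic q t) : ∃ P, IsMacdonaldFamily q t P := by
  have h1 : ∀ lam, ∃ P : SymFun K, P - msym K lam ∈ lowerSpan K lam ∧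
      symOp q t P = macEigenvalue q t lam • P := by
    intro lam
    obtain ⟨u, hu, hu'⟩ := lowerSpan_le_map h lam (symOp_msym h lam)
    refine ⟨msym K lam - u, ?_, ?_⟩
    · rw [sub_sub_cancel_left]
      exact Submodule.neg_mem _ hu
    · simp only [LinearMap.sub_apply, LinearMap.smul_apply, LinearMap.id_apply] at hu'
      rw [map_sub, smul_sub]
      linear_combination (exp := 1) -hu'
  choose P hP hP' using h1
  refine ⟨P, fun lam mu hne => ?_, fun lam => ?_⟩
  · have h2 := hall_symOp h (P lam) (P mu)
    rw [hP', hP', map_smul, map_smul, LinearMap.smul_apply, ← sub_eq_zero, ← sub_smul] at h2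
    rcases smul_eq_zero.1 h2 with h3 | h3
    · exact absurd (macEigenvalue_injective h (sub_eq_zero.1 h3)) hne
    · exact h3
  · obtain ⟨u, hu, hu'⟩ := (Finsupp.mem_span_image_iff_linearCombination K).1 (hP lam)
    refine ⟨u, fun mu hmu => ?_, ?_⟩
    · exact hu (Finsupp.mem_support_iff.2 hmu)
    · rw [← sub_eq_iff_eq_add', ← hu', Finsupp.linearCombination_apply]

end SymOp

/-! ### Properties of a family of Macdonald polynomials -/

section Family

variable {K : Type*} [Field K] [CharZero K] {q t : K} {P : YoungDiagram → SymFun K}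

lemma IsMacdonaldFamily.sub_mem (hP : IsMacdonaldFamily q t P) (lam : YoungDiagram) :
    P lam - msym K lam ∈ lowerSpan K lam := by
  obtain ⟨u, hu, hP⟩ := hP.2 lam
  rw [hP, add_sub_cancel_left]
  exact Submodule.sum_mem _ fun mu hmu => Submodule.smul_mem _ _
    (Submodule.subset_span ⟨mu, hu mu (Finsupp.mem_support_iff.1 hmu), rfl⟩)

lemma IsMacdonaldFamily.mem_span_msym (hP : IsMacdonaldFamily q t P) (lam : YoungDiagram) :
    P lam ∈ Submodule.span K (msym K '' {mu | DominatedBy mu lam}) := by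
  rw [← sub_add_cancel (P lam) (msym K lam)]
  refine Submodule.add_mem _ (Submodule.span_mono (Set.image_mono fun mu hmu => ?_)
    (hP.sub_mem lam)) (Submodule.subset_span ⟨lam, DominatedBy.refl lam, rfl⟩)
  exact hmu.1

lemma IsMacdonaldFamily.msym_mem_span (hP : IsMacdonaldFamily q t P) (lam : YoungDiagram) :
    msym K lam ∈ Submodule.span K (P '' {mu | DominatedBy mu lam}) := by
  induction hn : dominanceRank lam using Nat.strong_induction_on generalizing lam with
  | _ n ih =>
    rw [← sub_sub_cancel (P lam) (msym K lam)]
    refine Submodule.sub_mem _ (Submodule.subset_span ⟨lam, DominatedBy.refl lam, rfl⟩) ?_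
    have h1 : lowerSpan K lam ≤ Submodule.span K (P '' {mu | DominatedBy mu lam}) := by
      refine Submodule.span_le.2 ?_
      rintro _ ⟨mu, hmu, rfl⟩
      refine Submodule.span_mono (Set.image_mono fun kap hk => ?_)
        (ih _ (hn ▸ hmu.rank_lt) mu rfl)
      exact DominatedBy.trans hk hmu.1
    exact h1 (hP.sub_mem lam)

lemma IsMacdonaldFamily.lowerSpan_le (hP : IsMacdonaldFamily q t P) (lam : YoungDiagram) :
    lowerSpan K lam ≤ Submodule.span K (P '' {mu | StrictlyDominated mu lam}) := by
  refine Submodule.span_le.2 ?_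
  rintro _ ⟨mu, hmu, rfl⟩
  refine Submodule.span_mono (Set.image_mono fun kap hk => ?_) (hP.msym_mem_span mu)
  exact StrictlyDominated.trans_left hk hmu

omit [CharZero K] in
lemma mem_span_of_msym {S : Submodule K (SymFun K)} (h : ∀ lam, msym K lam ∈ S) (f : SymFun K) :
    f ∈ S := by
  obtain ⟨T, -, hf⟩ := eq_sum_msym f
  rw [hf]
  exact Submodule.sum_mem _ fun lam _ => Submodule.smul_mem _ _ (h lam)

lemma IsMacdonaldFamily.mem_span (hP : IsMacdonaldFamily q t P) (f : SymFun K) :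
    f ∈ Submodule.span K (Set.range P) :=
  mem_span_of_msym (fun lam => Submodule.span_mono (Set.image_subset_range _ _)
    (hP.msym_mem_span lam)) f

lemma hall_eq_zero_of_mem_span {S : Set (SymFun K)} {f x : SymFun K}
    (h : ∀ y ∈ S, hall q t f y = 0) (hx : x ∈ Submodule.span K S) : hall q t f x = 0 := by
  have : Submodule.span K S ≤ LinearMap.ker (hall q t f) := Submodule.span_le.2 h
  exact this hx

/-- Every coefficient of f is its pairing with a product of functions g_r. -/
lemma eq_zero_of_hall (h : Generic q t) {f : SymFun K} (hf : ∀ g, hall q t f g = 0) : f = 0 := by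
  apply Subtype.ext
  ext a
  obtain ⟨n, hn⟩ : ∃ n, ∀ i, n ≤ i → a i = 0 := by
    refine ⟨a.support.sup id + 1, fun i hi => ?_⟩
    by_contra h1
    have := Finset.le_sup (f := id) (Finsupp.mem_support_iff.2 h1)
    simp only [id] at this
    omega
  rw [← hall_hookProd h n a hn, hall_comm, hf]
  rfl

lemma IsMacdonaldFamily.eq_of_hall (h : Generic q t) (hP : IsMacdonaldFamily q t P)
    {f g : SymFun K} (hfg : ∀ lam, hall q t f (P lam) = hall q t g (P lam)) : f = g := by
  refine sub_eq_zero.1 (eq_zero_of_hall h fun x => ?_)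
  refine hall_eq_zero_of_mem_span ?_ (hP.mem_span x)
  rintro _ ⟨lam, rfl⟩
  rw [map_sub, LinearMap.sub_apply, hfg, sub_self]

lemma IsMacdonaldFamily.ne_zero (hP : IsMacdonaldFamily q t P) (lam : YoungDiagram) :
    P lam ≠ 0 := by
  classical
  intro h0
  obtain ⟨u, hu, h1⟩ := hP.2 lam
  have h2 : ∀ x ∈ lowerSpan K lam, coeff (expo lam) x.1 = 0 := by
    intro x hx
    induction hx using Submodule.span_induction with
    | mem x hx =>
      obtain ⟨mu, hmu, rfl⟩ := hx
      rw [coeff_expo_msym, if_neg (Ne.symm hmu.2)]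
    | zero => rfl
    | add x y _ _ hx hy =>
      change coeff (expo lam) x.1 + coeff (expo lam) y.1 = 0
      rw [hx, hy, add_zero]
    | smul c x _ hx =>
      change c * coeff (expo lam) x.1 = 0
      rw [hx, mul_zero]
  have h3 := h2 _ (hP.sub_mem lam)
  rw [h0, zero_sub] at h3
  change -coeff (expo lam) (msym K lam).1 = 0 at h3
  rw [coeff_expo_msym, if_pos rfl] at h3
  exact one_ne_zero (neg_eq_zero.1 h3)

lemma IsMacdonaldFamily.hall_self_ne_zero (h : Generic q t) (hP : IsMacdonaldFamily q t P)
    (lam : YoungDiagram) : hall q t (P lam) (P lam) ≠ 0 := by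
  intro h0
  refine hP.ne_zero lam (hP.eq_of_hall h fun mu => ?_)
  rw [map_zero, LinearMap.zero_apply]
  by_cases hlm : lam = mu
  · rw [← hlm, h0]
  · exact hP.1 _ _ hlm

/-- Test E P_lam - (eigenvalue) P_lam against each P_kap. If kap < lam, move E to P_kap, which
yields only P_rho with rho ≤ kap, all orthogonal to P_lam. Otherwise use that the difference is a
combination of P_rho with rho < lam, none of which is P_kap. -/
lemma IsMacdonaldFamily.symOp_apply (h : Generic q t) (hP : IsMacdonaldFamily q t P)
    (lam : YoungDiagram) : symOp q t (P lam) = macEigenvalue q t lam • P lam := by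
  have h1 : ∀ kap, symOp q t (P kap) - macEigenvalue q t kap • P kap ∈ lowerSpan K kap := by
    intro kap
    have h2 := Submodule.add_mem _ (symOp_msym h kap) (Submodule.sub_mem _
      (symOp_lowerSpan h (hP.sub_mem kap))
      (Submodule.smul_mem _ (macEigenvalue q t kap) (hP.sub_mem kap)))
    rw [map_sub, smul_sub] at h2
    convert h2 using 1
    abel
  refine sub_eq_zero.1 (hP.eq_of_hall h fun kap => ?_)
  rw [map_zero, LinearMap.zero_apply]
  by_cases hk : StrictlyDominated kap lam
  · have h2 : hall q t (P lam) (symOp q t (P kap) - macEigenvalue q t kap • P kap) = 0 := by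
      refine hall_eq_zero_of_mem_span ?_ (hP.lowerSpan_le kap (h1 kap))
      rintro _ ⟨rho, hr, rfl⟩
      refine hP.1 _ _ ?_
      rintro rfl
      exact hk.2 (hk.1.antisymm hr.1)
    rw [map_sub, map_smul, hP.1 _ _ (Ne.symm hk.2), smul_zero, sub_zero] at h2
    rw [map_sub, map_smul, LinearMap.sub_apply, LinearMap.smul_apply, hP.1 _ _ (Ne.symm hk.2),
      smul_zero, sub_zero, hall_symOp h, h2]
  · rw [hall_comm]
    refine hall_eq_zero_of_mem_span ?_ (hP.lowerSpan_le lam (h1 lam))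
    rintro _ ⟨rho, hr, rfl⟩
    refine hP.1 _ _ ?_
    rintro rfl
    exact hk hr

/-! ### Degrees -/

/-- `f` is homogeneous of degree `d`. -/
def HasDegree (f : SymFun K) (d : ℕ) : Prop := ∀ a, coeff a f.1 ≠ 0 → a.degree = d

omit [CharZero K] in
lemma HasDegree.mul {f g : SymFun K} {d e : ℕ} (hf : HasDegree f d) (hg : HasDegree g e) :
    HasDegree (f * g) (d + e) := by
  classical
  intro a ha
  change coeff a (f.1 * g.1) ≠ 0 at ha
  rw [coeff_mul] at ha
  obtain ⟨⟨b, c⟩, hbc, hne⟩ := Finset.exists_ne_zero_of_sum_ne_zero ha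
  rw [Finset.HasAntidiagonal.mem_antidiagonal] at hbc
  simp only at hbc hne
  rw [← hbc, map_add, hf b (left_ne_zero_of_mul hne), hg c (right_ne_zero_of_mul hne)]

omit [CharZero K] in
lemma hasDegree_of_mem_span {S : Set (SymFun K)} {d : ℕ} (hS : ∀ f ∈ S, HasDegree f d)
    {f : SymFun K} (hf : f ∈ Submodule.span K S) : HasDegree f d := by
  induction hf using Submodule.span_induction with
  | mem x hx => exact hS x hx
  | zero => exact fun a ha => absurd rfl ha
  | add x y _ _ hx hy =>
    intro a ha
    change coeff a x.1 + coeff a y.1 ≠ 0 at ha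
    by_cases h : coeff a x.1 = 0
    · rw [h, zero_add] at ha
      exact hy a ha
    · exact hx a h
  | smul c x _ hx => exact fun a ha => hx a (right_ne_zero_of_mul ha)

omit [CharZero K] in
lemma hasDegree_msym (lam : YoungDiagram) : HasDegree (msym K lam) lam.card := by
  classical
  intro a ha
  rw [coeff_msym] at ha
  have h : expParts a = (lam.rowLens : Multiset ℕ) := by
    by_contra h
    exact ha (if_neg h)
  rw [degree_eq_expParts, h, ← expParts_expo, ← degree_eq_expParts, degree_expo]

lemma IsMacdonaldFamily.hasDegree (hP : IsMacdonaldFamily q t P) (lam : YoungDiagram) :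
    HasDegree (P lam) lam.card := by
  refine hasDegree_of_mem_span ?_ (hP.mem_span_msym lam)
  rintro _ ⟨mu, hmu, rfl⟩
  rw [← hmu.1]
  exact hasDegree_msym mu

lemma IsMacdonaldFamily.hall_eq_zero_of_hasDegree (hP : IsMacdonaldFamily q t P)
    {lam : YoungDiagram} {f : SymFun K} {d : ℕ} (hf : HasDegree f d) (hd : lam.card ≠ d) :
    hall q t (P lam) f = 0 := by
  have h1 : f ∈ Submodule.span K (msym K '' {mu | mu.card = d}) :=
    mem_span_msym_of_coeff fun mu hmu => (degree_expo mu).symm.trans (hf _ hmu)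
  refine hall_eq_zero_of_mem_span ?_ h1
  rintro _ ⟨mu, hmu, rfl⟩
  refine hall_eq_zero_of_mem_span ?_ (hP.msym_mem_span mu)
  rintro _ ⟨kap, hk, rfl⟩
  refine hP.1 _ _ ?_
  rintro rfl
  exact hd (hk.1.trans hmu)

lemma finite_card_le (N : ℕ) : {lam : YoungDiagram | lam.card ≤ N}.Finite := by
  refine (finite_sum_le N).subset fun lam hl => ?_
  have h1 : lam.rowLens.sum = lam.card := by
    rw [← degree_expo, degree_eq_expParts, expParts_expo, Multiset.sum_coe]
  change lam.rowLens.sum ≤ N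
  rw [h1]
  exact hl

/-! ### Macdonald polynomials as combinations of products of the `g_r` -/

/-- By duality P_mu = ∑ ⟨P_mu, m_kap⟩ g_kap. Since m_kap is a combination of P_rho with rho ≤ kap,
only kap ≥ mu contribute, and these have at most ℓ(mu) parts. -/
lemma IsMacdonaldFamily.mem_span_hookProd (h : Generic q t) (hP : IsMacdonaldFamily q t P)
    (mu : YoungDiagram) :
    P mu ∈ Submodule.span K (Set.range (hookProd q t (mu.colLen 0) 0)) := by
  classical
  set n := mu.colLen 0
  set T := (finite_card_le mu.card).toFinset.filter fun kap => kap.colLen 0 ≤ n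
  have h1 : P mu = ∑ kap ∈ T, hall q t (P mu) (msym K kap) • hookProd q t n 0 (expo kap) := by
    refine sub_eq_zero.1 (eq_zero_of_hall h fun x => ?_)
    refine hall_eq_zero_of_mem_span (S := Set.range (msym K)) ?_
      (mem_span_of_msym (fun lam => Submodule.subset_span (Set.mem_range_self lam)) x)
    rintro _ ⟨rho, rfl⟩
    rw [map_sub, LinearMap.sub_apply, map_sum, LinearMap.sum_apply, sub_eq_zero]
    have h2 : ∀ kap ∈ T, hall q t (hall q t (P mu) (msym K kap) • hookProd q t n 0 (expo kap))
        (msym K rho) = if kap = rho then hall q t (P mu) (msym K kap) else 0 := by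
      intro kap hk
      rw [map_smul, LinearMap.smul_apply, hall_hookProd h n (expo kap), coeff_expo_msym]
      · simp
      · intro i hi
        exact rowLen_eq_zero ((Finset.mem_filter.1 hk).2.trans hi)
    rw [Finset.sum_congr rfl h2, Finset.sum_ite_eq']
    split_ifs with hr
    · rfl
    · by_cases hc : mu.card = rho.card
      · refine hall_eq_zero_of_mem_span ?_ (hP.msym_mem_span rho)
        rintro _ ⟨kap, hk, rfl⟩
        refine hP.1 _ _ ?_
        rintro rfl
        refine hr (Finset.mem_filter.2 ⟨?_, DominatedBy.colLen_le hk⟩)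
        rw [Set.Finite.mem_toFinset]
        exact hc.ge
      · exact hP.hall_eq_zero_of_hasDegree (hasDegree_msym rho) hc
  rw [h1]
  exact Submodule.sum_mem _ fun kap _ => Submodule.smul_mem _ _ 
    (Submodule.subset_span (Set.mem_range_self _))

end Family

/-! ### Elementary symmetric functions -/

section Elementary

variable {K : Type*} [Field K] [CharZero K] {q t : K}

lemma powerForm_one_eFactor (l : ℕ) :
    powerForm q t 1 ((eFactor q t).seq l) = if l = 0 then 1 else 0 := by
  classical
  have h1 := expSeq_adjoint (powerForm q t) (w := powerNorm q t) (c := fun _ => -1)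
    (κ := fun k => ((k : K) + 1)⁻¹ * (-1 * powerNorm q t k)) (powerForm_X_mul q t) (fun k => by
      have : (k : K) + 1 ≠ 0 := by exact_mod_cast k.succ_ne_zero
      rw [mul_inv_cancel_left₀ this]) l 1 1
  rw [mul_one, map_one (shiftHom _), Polynomial.coeff_one] at h1
  rw [powerForm_comm]
  refine h1.trans ?_
  split_ifs with h
  · have := powerForm_monomial q t 0 0
    simpa using this
  · rw [map_zero]

/-- Adjoining a variable z multiplies the generating series ∏ (1 - x_i w) by 1 - z w, so only n = 0
and n = 1 survive. -/
lemma coeff_shift_eFactor (l n : ℕ) :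
    (shiftHom (fun _ => (1 : K)) ((eFactor q t).seq l)).coeff n =
      if n ≤ l ∧ n ≤ 1 then (-1 : K) ^ n • (eFactor q t).seq (l - n) else 0 := by
  have h1 : ∀ i, expSeq (fun _ => (-1 : K) * 1) i =
      if i = 0 then 1 else if i = 1 then -1 else 0 := by
    intro i
    have := expSeq_neg_geom (1 : K) i
    simpa using this
  have h2 : shiftHom (fun _ => (1 : K)) ((eFactor q t).seq l) =
      ∑ i ∈ Finset.range (l + 1), Polynomial.C (expSeq (fun _ => (-1 : K) * 1) i •
        (eFactor q t).seq (l - i)) * Polynomial.X ^ i := shiftHom_expSeq _ _ _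
  rw [h2, Polynomial.finsetSum_coeff]
  simp only [Polynomial.coeff_C_mul_X_pow, h1]
  rw [Finset.sum_ite_eq]
  by_cases hn : n ≤ l
  · rw [if_pos (Finset.mem_range.2 (by omega))]
    by_cases h0 : n = 0
    · simp [h0]
    · by_cases h2 : n = 1
      · subst h2
        simp [hn]
      · rw [if_neg h0, if_neg h2, if_neg (by omega), zero_smul]
  · rw [if_neg (by simpa using hn), if_neg (by omega)]

lemma powerForm_gProd_eFactor (h : Generic q t) (N : ℕ) (r : ℕ → ℕ) (l : ℕ) :
    powerForm q t (gProd q t N r) ((eFactor q t).seq l) =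
      if (∀ i < N, r i ≤ 1) ∧ ∑ i ∈ Finset.range N, r i = l then (-1) ^ l else 0 := by
  induction N generalizing r l with
  | zero =>
    refine (powerForm_one_eFactor l).trans ?_
    by_cases hl : l = 0
    · simp [hl]
    · rw [if_neg hl, if_neg]
      simpa using Ne.symm hl
  | succ N ih =>
    rw [gProd_succ, powerForm_gFactor_mul h, coeff_shift_eFactor]
    rw [Finset.sum_range_succ']
    by_cases h1 : r 0 ≤ l ∧ r 0 ≤ 1
    · rw [if_pos h1, map_smul, ih, smul_eq_mul, mul_ite, mul_zero, ← pow_add,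
        Nat.add_sub_cancel' h1.1]
      refine if_congr ⟨fun h => ⟨fun i hi => ?_, by omega⟩,
        fun h => ⟨fun i hi => h.1 _ (by omega), by omega⟩⟩ rfl rfl
      cases i with
      | zero => exact h1.2
      | succ i => exact h.1 i (by omega)
    · rw [if_neg h1, map_zero, if_neg]
      rintro ⟨h2, h3⟩
      exact h1 ⟨by omega, h2 0 (by omega)⟩

/-- The elementary symmetric function of degree `l`, up to sign. -/
def esym (q t : K) (l : ℕ) : SymFun K := powerHom K ((eFactor q t).seq l)

lemma coeff_esym (h : Generic q t) (l : ℕ) (a : ℕ →₀ ℕ)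
    [Decidable ((∀ i, a i ≤ 1) ∧ a.degree = l)] :
    coeff a (esym q t l).1 = if (∀ i, a i ≤ 1) ∧ a.degree = l then (-1) ^ l else 0 := by
  classical
  obtain ⟨n, hn⟩ : ∃ n, ∀ i, n ≤ i → a i = 0 := by
    refine ⟨a.support.sup id + 1, fun i hi => ?_⟩
    by_contra h1
    have := Finset.le_sup (f := id) (Finsupp.mem_support_iff.2 h1)
    simp only [id] at this
    omega
  rw [esym, coeff_powerHom h _ n a hn, powerForm_gProd_eFactor h]
  refine if_congr ?_ rfl rfl
  rw [degree_eq_sum_range a hn]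
  refine and_congr_left' ⟨fun h i => ?_, fun h i _ => h i⟩
  by_cases hi : i < n
  · exact h i hi
  · rw [hn i (by omega)]
    omega

lemma esym_mul_hookProd_mem (l m : ℕ) {x : SymFun K}
    (hx : x ∈ Submodule.span K (Set.range (hookProd q t 0 m))) :
    esym q t l * x ∈ Submodule.span K (Set.range (hookProd q t 0 (m + 1))) := by
  induction hx using Submodule.span_induction with
  | mem x hx =>
    obtain ⟨r, rfl⟩ := hx
    refine Submodule.subset_span ⟨consSeq l r, ?_⟩
    change powerHom K ((eFactor q t).seq l * _) = _
    rw [map_mul]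
    rfl
  | zero => rw [mul_zero]; exact Submodule.zero_mem _
  | add x y _ _ hx hy => rw [mul_add]; exact Submodule.add_mem _ hx hy
  | smul c x _ hx => rw [mul_smul_comm]; exact Submodule.smul_mem _ _ hx

/-- Remove the first column of the exponents. -/
def stripColumn (lam : YoungDiagram) : ℕ →₀ ℕ := (expo lam).mapRange Nat.pred rfl

/-- The first column of a partition, as an exponent. -/
def firstColumn (lam : YoungDiagram) : ℕ →₀ ℕ :=
  Finsupp.indicator (Finset.range (lam.colLen 0)) fun _ _ => 1

lemma stripColumn_apply (lam : YoungDiagram) (i : ℕ) : stripColumn lam i = lam.rowLen i - 1 := rfl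

lemma firstColumn_apply (lam : YoungDiagram) (i : ℕ) :
    firstColumn lam i = if i < lam.colLen 0 then 1 else 0 := by
  classical
  rw [firstColumn, Finsupp.indicator_apply]
  simp

lemma one_le_rowLen {lam : YoungDiagram} {i : ℕ} (h : i < lam.colLen 0) : 1 ≤ lam.rowLen i :=
  YoungDiagram.mem_iff_lt_rowLen.1 (YoungDiagram.mem_iff_lt_colLen.2 h)

lemma firstColumn_add_stripColumn (lam : YoungDiagram) :
    firstColumn lam + stripColumn lam = expo lam := by
  ext i
  rw [Finsupp.add_apply, stripColumn_apply, firstColumn_apply, expo_apply]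
  split_ifs with h
  · have := one_le_rowLen h
    omega
  · rw [rowLen_eq_zero (not_lt.1 h)]

lemma degree_firstColumn (lam : YoungDiagram) : (firstColumn lam).degree = lam.colLen 0 := by
  rw [degree_eq_sum_range (n := lam.colLen 0)]
  · rw [Finset.sum_congr rfl (g := fun _ => 1)]
    · simp
    · intro i hi
      rw [firstColumn_apply, if_pos (Finset.mem_range.1 hi)]
  · intro i hi
    rw [firstColumn_apply, if_neg (by omega)]

lemma antitone_stripColumn (lam : YoungDiagram) : Antitone (stripColumn lam) := fun _ _ h =>
  Nat.sub_le_sub_right (antitone_rowLen lam h) 1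

/-- A vertical strip of size `k` contained in a partition of length at most `k` is its first
column. -/
lemma eq_firstColumn {lam : YoungDiagram} {b : ℕ →₀ ℕ} {k : ℕ} (hb : ∀ i, b i ≤ 1)
    (hdeg : b.degree = k) (hle : b ≤ expo lam) (hk : lam.colLen 0 ≤ k) :
    b = firstColumn lam ∧ lam.colLen 0 = k := by
  have h0 : ∀ i, lam.colLen 0 ≤ i → b i = 0 := fun i hi => by
    have := hle i
    rw [expo_apply, rowLen_eq_zero hi] at this
    omega
  have h1 : ∑ i ∈ Finset.range (lam.colLen 0), b i ≤ ∑ i ∈ Finset.range (lam.colLen 0), 1 :=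
    Finset.sum_le_sum fun i _ => hb i
  rw [← degree_eq_sum_range b h0, hdeg, Finset.sum_const, Finset.card_range, smul_eq_mul,
    mul_one] at h1
  have hkl : lam.colLen 0 = k := le_antisymm hk h1
  refine ⟨?_, hkl⟩
  have h2 : ∑ i ∈ Finset.range (lam.colLen 0), b i = ∑ i ∈ Finset.range (lam.colLen 0), 1 := by
    rw [← degree_eq_sum_range b h0, hdeg, Finset.sum_const, Finset.card_range, smul_eq_mul,
      mul_one, hkl]
  rw [Finset.sum_eq_sum_iff_of_le fun i _ => hb i] at h2
  ext i
  rw [firstColumn_apply]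
  split_ifs with hi
  · exact h2 i (Finset.mem_range.2 hi)
  · exact h0 i (not_lt.1 hi)

/-- Strip the first column from kap to get tau, and expand e_(ℓ(kap)) m_tau. Here m_kap occurs with
nonzero coefficient, and any other m_rho has the same size, more parts and first part still within
the bound. So m_tau is handled by induction on m, and the m_rho by induction on size minus length.
-/
lemma msym_mem_span_esym (h : Generic q t) (m : ℕ) : ∀ kap : YoungDiagram, kap.rowLen 0 ≤ m →
    msym K kap ∈ Submodule.span K (Set.range (hookProd q t 0 m)) := by
  classical
  induction m with
  | zero =>
    intro kap hk
    have h1 : expo kap = 0 := by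
      ext i
      have := antitone_rowLen kap (Nat.zero_le i)
      rw [expo_apply, Finsupp.zero_apply]
      omega
    have h2 : msym K kap = 1 := by
      apply Subtype.ext
      ext a
      change _ = coeff a (1 : MvPowerSeries ℕ K)
      rw [coeff_msym, coeff_one]
      refine if_congr ?_ rfl rfl
      rw [← expParts_expo, h1]
      simp [expParts]
    rw [h2]
    refine Submodule.subset_span ⟨0, ?_⟩
    exact map_one (powerHom K)
  | succ m ihm =>
    intro kap hk
    induction hn : kap.card - kap.colLen 0 using Nat.strong_induction_on generalizing kap with
    | _ n ih =>
      obtain ⟨tau, htau⟩ := exists_rowLens_eq (stripColumn kap)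
      have htau' : tau.rowLen 0 ≤ m := by
        rw [← expParts_expo] at htau
        obtain ⟨e, he⟩ := exists_perm_of_expParts_eq htau
        have h1 : tau.rowLen 0 = stripColumn kap (e.symm 0) := by
          rw [← expo_apply, he]
          conv_lhs => rw [← e.apply_symm_apply 0]
          rw [Finsupp.mapDomain_apply e.injective]
        rw [h1, stripColumn_apply]
        have := antitone_rowLen kap (Nat.zero_le (e.symm 0))
        omega
      set l := kap.colLen 0 with hl
      set f := esym q t l * msym K tau with hf
      have hfm : f ∈ Submodule.span K (Set.range (hookProd q t 0 (m + 1))) :=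
        esym_mul_hookProd_mem l m (ihm tau htau')
      have hcoeff : ∀ a, coeff a f.1 = ∑ x ∈ Finset.HasAntidiagonal.antidiagonal a,
          coeff x.1 (esym q t l).1 * coeff x.2 (msym K tau).1 := fun a => coeff_mul a _ _
      have hterm : ∀ b c : ℕ →₀ ℕ, coeff b (esym q t l).1 * coeff c (msym K tau).1 ≠ 0 →
          (∀ i, b i ≤ 1) ∧ b.degree = l ∧ expParts c = expParts (stripColumn kap) := by
        intro b c hbc
        have h1 := left_ne_zero_of_mul hbc
        have h2 := right_ne_zero_of_mul hbc
        rw [coeff_esym h] at h1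
        rw [coeff_msym] at h2
        have h3 : (∀ i, b i ≤ 1) ∧ b.degree = l := by
          by_contra h3
          exact h1 (if_neg h3)
        refine ⟨h3.1, h3.2, ?_⟩
        rw [← htau]
        by_contra h4
        exact h2 (if_neg h4)
      have hdeg : ∀ c : ℕ →₀ ℕ, expParts c = expParts (stripColumn kap) →
          l + c.degree = kap.card := by
        intro c hc
        rw [degree_eq_expParts, hc, ← degree_eq_expParts, hl, ← degree_firstColumn, ← map_add,
          firstColumn_add_stripColumn, degree_expo]
      have hself : coeff (expo kap) f.1 ≠ 0 := by
        -- A vertical strip of size ℓ(kap) inside kap must be its whole first column, so a single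
        -- factorization contributes.
        rw [hcoeff, Finset.sum_eq_single (firstColumn kap, stripColumn kap)]
        · rw [coeff_esym h, if_pos, coeff_msym, if_pos htau.symm, mul_one]
          · exact pow_ne_zero _ (neg_ne_zero.2 one_ne_zero)
          · refine ⟨fun i => ?_, degree_firstColumn kap⟩
            rw [firstColumn_apply]
            split_ifs <;> omega
        · rintro ⟨b, c⟩ hbc hne
          by_contra h1
          obtain ⟨hb, hbl, -⟩ := hterm b c h1
          rw [Finset.HasAntidiagonal.mem_antidiagonal] at hbc
          simp only at hbc
          obtain ⟨rfl, -⟩ := eq_firstColumn hb hbl (hbc ▸ le_self_add) le_rfl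
          rw [← firstColumn_add_stripColumn kap] at hbc
          exact hne (Prod.ext rfl (add_left_cancel hbc))
        · intro h1
          exact absurd (Finset.HasAntidiagonal.mem_antidiagonal.2 (firstColumn_add_stripColumn kap))
            h1
      have hother : ∀ rho, coeff (expo rho) f.1 ≠ 0 → rho ≠ kap →
          rho.rowLen 0 ≤ m + 1 ∧ rho.card = kap.card ∧ l < rho.colLen 0 := by
        intro rho hr hne
        rw [hcoeff] at hr
        obtain ⟨⟨b, c⟩, hbc, hne'⟩ := Finset.exists_ne_zero_of_sum_ne_zero hr
        obtain ⟨hb, hbl, hc⟩ := hterm b c hne'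
        rw [Finset.HasAntidiagonal.mem_antidiagonal] at hbc
        simp only at hbc
        refine ⟨?_, ?_, ?_⟩
        · obtain ⟨e, rfl⟩ := exists_perm_of_expParts_eq hc
          have h1 := DFunLike.congr_fun hbc 0
          rw [expo_apply, Finsupp.add_apply] at h1
          have h2 : (stripColumn kap).mapDomain e 0 = stripColumn kap (e.symm 0) := by
            conv_lhs => rw [← e.apply_symm_apply 0]
            rw [Finsupp.mapDomain_apply e.injective]
          rw [h2, stripColumn_apply] at h1
          have := antitone_rowLen kap (Nat.zero_le (e.symm 0))
          have := hb 0
          omega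
        · rw [← degree_expo, ← hbc, map_add, hbl, hdeg c hc]
        -- If rho had at most l parts, the strip would be its whole first column. The rest of rho
        -- would then be a rearrangement of the rest of kap; both are decreasing, so rho = kap.
        · by_contra hlt
          obtain ⟨rfl, hlr⟩ := eq_firstColumn hb hbl (hbc ▸ le_self_add) (not_lt.1 hlt)
          rw [← firstColumn_add_stripColumn rho] at hbc
          obtain rfl : c = stripColumn rho := add_left_cancel hbc
          have h1 : (stripColumn rho : ℕ → ℕ) = stripColumn kap := eq_of_sum_range_eq fun k =>
            le_antisymm (sum_range_le_of_antitone hc (antitone_stripColumn kap) k)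
              (sum_range_le_of_antitone hc.symm (antitone_stripColumn rho) k)
          refine hne (eq_of_rowLen_eq fun i => ?_)
          have h2 := congrFun h1 i
          rw [stripColumn_apply, stripColumn_apply] at h2
          by_cases hi : i < l
          · have := one_le_rowLen (lam := kap) hi
            have := one_le_rowLen (lam := rho) (hlr ▸ hi)
            omega
          · rw [rowLen_eq_zero (lam := kap) (not_lt.1 hi),
              rowLen_eq_zero (lam := rho) (hlr ▸ not_lt.1 hi)]
      obtain ⟨S, hS, hsum⟩ := eq_sum_msym f
      have hkS : kap ∈ S := by
        by_contra hkS
        apply hself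
        rw [hsum, AddSubmonoidClass.coe_finsetSum, map_sum]
        refine Finset.sum_eq_zero fun rho hr => ?_
        change _ * coeff (expo kap) (msym K rho).1 = 0
        rw [coeff_expo_msym, if_neg, mul_zero]
        rintro rfl
        exact hkS hr
      rw [← Finset.add_sum_erase _ _ hkS, ← sub_eq_iff_eq_add] at hsum
      rw [← Submodule.smul_mem_iff _ hself, ← hsum]
      refine Submodule.sub_mem _ hfm (Submodule.sum_mem _ fun rho hr => Submodule.smul_mem _ _ ?_)
      obtain ⟨hne, hr⟩ := Finset.mem_erase.1 hr
      obtain ⟨h1, h2, h3⟩ := hother rho (hS rho hr) hne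
      refine ih _ ?_ rho h1 rfl
      have := colLen_zero_le_card rho
      omega

end Elementary

/-! ### Vanishing of Littlewood-Richardson coefficients -/

section Vanishing

variable {K : Type*} [Field K] [CharZero K] {q t : K} {P : YoungDiagram → SymFun K}

/-- The sum of the partial sums, a strictly monotone function for dominance of sequences. -/
def sequenceRank (N : ℕ) (r : ℕ → ℕ) : ℕ :=
  ∑ k ∈ Finset.range (N + 1), ∑ i ∈ Finset.range k, r i

lemma sum_range_eq_of_le {N : ℕ} {r : ℕ → ℕ} (hr : ∀ i, N ≤ i → r i = 0) {k : ℕ} (hk : N ≤ k) :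
    ∑ i ∈ Finset.range k, r i = ∑ i ∈ Finset.range N, r i := by
  refine (Finset.sum_subset (Finset.range_mono hk) fun i _ hi => hr i ?_).symm
  simpa using hi

lemma sequenceRank_lt {N : ℕ} {r r' : ℕ → ℕ} (hr : ∀ i, N ≤ i → r i = 0)
    (hr' : r' ∈ dominating N 0 r \ {r}) : sequenceRank N r < sequenceRank N r' := by
  obtain ⟨⟨h1, h2, h3⟩, hne⟩ := hr'
  refine Finset.sum_lt_sum (fun k _ => h3 k) ?_
  by_contra hcon
  push Not at hcon
  refine hne (eq_of_sum_range_eq fun k => le_antisymm ?_ (h3 k))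
  by_cases hk : k < N + 1
  · exact hcon k (Finset.mem_range.2 hk)
  · rw [sum_range_eq_of_le hr (by omega : N ≤ k), sum_range_eq_of_le h1 (by omega : N ≤ k), ← h2,
      add_zero]

lemma sequenceRank_le {N : ℕ} {r : ℕ → ℕ} :
    sequenceRank N r ≤ (N + 1) * ∑ i ∈ Finset.range N, r i := by
  calc sequenceRank N r ≤ ∑ k ∈ Finset.range (N + 1), ∑ i ∈ Finset.range N, r i :=
        Finset.sum_le_sum fun k hk => Finset.sum_le_sum_of_subset
          (Finset.range_mono (Nat.lt_succ_iff.1 (Finset.mem_range.1 hk)))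
    _ = _ := by simp

/-- Pair P_lam with E applied to the product. By induction the off-diagonal terms are orthogonal to
P_lam, so the pairing is killed by the difference of two box eigenvalues. That difference is
nonzero, because the box (n, m) lies in lam but never in `hookBoxes n m r`. The induction terminates
because `sequenceRank` increases and is bounded for a fixed total. -/
lemma IsMacdonaldFamily.hall_hookProd_eq_zero (h : Generic q t) (hP : IsMacdonaldFamily q t P)
    {lam : YoungDiagram} {n m : ℕ} (hlam : m < lam.rowLen n) (r : ℕ → ℕ)
    (hr : ∀ i, n + m ≤ i → r i = 0) : hall q t (P lam) (hookProd q t n m r) = 0 := by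
  induction hk : (n + m + 1) * ∑ i ∈ Finset.range (n + m), r i - sequenceRank (n + m) r
    using Nat.strong_induction_on generalizing r with
  | _ k ih =>
    have h1 := hall_eq_zero_of_mem_span (q := q) (t := t) (f := P lam) ?_
      (symOp_hookProd h n m r hr)
    · rw [map_sub, ← hall_symOp h, hP.symOp_apply h, map_smul, map_smul, LinearMap.smul_apply,
        ← sub_smul] at h1
      rcases smul_eq_zero.1 h1 with h2 | h2
      · exfalso
        have h3 := boxEigenvalue_injective h (sub_eq_zero.1 h2)
        have h4 : (n, m) ∈ lam.cells := by
          rw [YoungDiagram.mem_cells, YoungDiagram.mem_iff_lt_rowLen]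
          exact hlam
        rw [h3, mem_hookBoxes] at h4
        omega
      · exact h2
    · rintro _ ⟨r', hr', rfl⟩
      refine ih _ ?_ r' hr'.1.1 rfl
      have h2 := sequenceRank_lt hr hr'
      have h3 := sequenceRank_le (N := n + m) (r := r')
      have h4 := hr'.1.2.1
      rw [add_zero] at h4
      rw [h4] at h3 ⊢
      omega

omit [Field K] [CharZero K] in
lemma factorProd_congr {R : Type*} [CommRing R] {Φ : List (Factor K R)} {r r' : ℕ → ℕ}
    (h : ∀ i < Φ.length, r i = r' i) : factorProd Φ r = factorProd Φ r' := by
  induction Φ generalizing r r' with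
  | nil => rfl
  | cons φ Φ ih =>
    rw [factorProd, factorProd, h 0 (by simp)]
    congr 1
    exact ih fun i hi => h _ (by simpa using hi)

omit [Field K] [CharZero K] in
lemma factorProd_append {R : Type*} [CommRing R] (Φ Ψ : List (Factor K R)) (r r' : ℕ → ℕ) :
    factorProd Φ r * factorProd Ψ r' =
      factorProd (Φ ++ Ψ) fun i => if i < Φ.length then r i else r' (i - Φ.length) := by
  induction Φ generalizing r with
  | nil => simp [factorProd]
  | cons φ Φ ih =>
    rw [factorProd, List.cons_append, factorProd, mul_assoc, ih]
    simp

lemma hookProd_mul (n m : ℕ) (r r' : ℕ → ℕ) :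
    ∃ r'' : ℕ → ℕ, (∀ i, n + m ≤ i → r'' i = 0) ∧
      hookProd q t n 0 r * hookProd q t 0 m r' = hookProd q t n m r'' := by
  -- The product does not see the entries from n + m on; setting them to 0 meets the support
  -- condition of the triangularity lemma.
  refine ⟨fun i => if i < n + m then (if i < n then r i else r' (i - n)) else 0,
    fun i hi => if_neg (by omega), ?_⟩
  rw [hookProd, hookProd, ← map_mul, List.replicate_zero, List.replicate_zero, List.append_nil,
    List.nil_append, factorProd_append, hookProd]
  congr 1
  refine factorProd_congr fun i hi => ?_
  simp only [List.length_append, List.length_replicate] at hi ⊢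
  rw [if_pos hi]

/-- The product P_mu P_nu is a combination of products of ℓ(mu) functions g_r and nu_1 elementary
functions, and the hypothesis places the box (ℓ(mu), nu_1) in lam. -/
lemma IsMacdonaldFamily.hall_mul_eq_zero (h : Generic q t) (hP : IsMacdonaldFamily q t P)
    {lam mu nu : YoungDiagram} (hnu : nu.rowLen 0 < lam.rowLen (mu.colLen 0)) :
    hall q t (P lam) (P mu * P nu) = 0 := by
  have h1 : P nu ∈ Submodule.span K (Set.range (hookProd q t 0 (nu.rowLen 0))) := by
    have h2 : Submodule.span K (msym K '' {kap | DominatedBy kap nu}) ≤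
        Submodule.span K (Set.range (hookProd q t 0 (nu.rowLen 0))) := by
      refine Submodule.span_le.2 ?_
      rintro _ ⟨kap, hk, rfl⟩
      exact msym_mem_span_esym h _ kap (DominatedBy.rowLen_le hk)
    exact h2 (hP.mem_span_msym nu)
  have h2 := Submodule.mul_mem_mul (hP.mem_span_hookProd h mu) h1
  rw [Submodule.span_mul_span] at h2
  refine hall_eq_zero_of_mem_span ?_ h2
  rintro _ ⟨_, ⟨r, rfl⟩, _, ⟨r', rfl⟩, rfl⟩
  obtain ⟨r'', hr'', h3⟩ := hookProd_mul (q := q) (t := t) (mu.colLen 0) (nu.rowLen 0) r r'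
  simp only
  rw [h3]
  exact hP.hall_hookProd_eq_zero h hnu r'' hr''

/-! ### Skew Macdonald polynomials -/

lemma macP_isMacdonaldFamily (h : Generic q t) : IsMacdonaldFamily q t (macP q t) :=
  Classical.epsilon_spec (exists_macdonaldFamily h)

lemma macB_ne_zero (h : Generic q t) (lam : YoungDiagram) : macB q t lam ≠ 0 :=
  inv_ne_zero ((macP_isMacdonaldFamily h).hall_self_ne_zero h lam)

lemma hall_macP_macQ (h : Generic q t) (lam mu : YoungDiagram) [Decidable (lam = mu)] :
    hall q t (macP q t lam) (macQ q t mu) = if lam = mu then 1 else 0 := by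
  rw [macQ, map_smul, smul_eq_mul]
  split_ifs with hlm
  · subst hlm
    exact inv_mul_cancel₀ ((macP_isMacdonaldFamily h).hall_self_ne_zero h lam)
  · rw [(macP_isMacdonaldFamily h).1 _ _ hlm, mul_zero]

lemma hall_macQ_mul_macQ (lam mu nu : YoungDiagram) :
    hall q t (macP q t lam) (macQ q t mu * macQ q t nu) =
      macB q t mu * macB q t nu * hall q t (macP q t lam) (macP q t mu * macP q t nu) := by
  rw [macQ, macQ, smul_mul_smul_comm, map_smul, smul_eq_mul]

lemma lrCoeff_eq (lam mu nu : YoungDiagram) : lrCoeff q t lam mu nu =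
    macB q t lam * hall q t (macP q t lam) (macP q t mu * macP q t nu) := by
  rw [lrCoeff, macQ, map_smul, LinearMap.smul_apply, smul_eq_mul]

lemma hall_macP_mul_macP_of_card_ne (h : Generic q t) {lam mu nu : YoungDiagram}
    (hc : mu.card + nu.card ≠ lam.card) :
    hall q t (macP q t lam) (macP q t mu * macP q t nu) = 0 :=
  (macP_isMacdonaldFamily h).hall_eq_zero_of_hasDegree
    (((macP_isMacdonaldFamily h).hasDegree mu).mul ((macP_isMacdonaldFamily h).hasDegree nu))
    hc.symm

/-- The coefficients of a skew Macdonald polynomial. -/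
def skewCoeff (q t : K) (lam mu : YoungDiagram) : YoungDiagram →₀ K :=
  Finsupp.indicator (finite_card_le lam.card).toFinset fun nu _ =>
    hall q t (macP q t lam) (macQ q t mu * macQ q t nu)

/-- The pairing vanishes unless the sizes add up, so restricting the support to |nu| ≤ |lam| loses
nothing. -/
lemma skewCoeff_apply (h : Generic q t) (lam mu nu : YoungDiagram) :
    skewCoeff q t lam mu nu = hall q t (macP q t lam) (macQ q t mu * macQ q t nu) := by
  classical
  rw [skewCoeff, Finsupp.indicator_apply]
  split_ifs with hn
  · rfl
  · rw [hall_macQ_mul_macQ, hall_macP_mul_macP_of_card_ne h, mul_zero]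
    intro hc
    refine hn ((Set.Finite.mem_toFinset _).2 ?_)
    change nu.card ≤ lam.card
    omega

lemma hall_sum_macP (h : Generic q t) (r : YoungDiagram →₀ K) (nu : YoungDiagram) :
    hall q t (r.sum fun nu c => c • macP q t nu) (macQ q t nu) = r nu := by
  classical
  rw [Finsupp.sum, map_sum, LinearMap.sum_apply]
  simp only [map_smul, LinearMap.smul_apply, hall_macP_macQ h, smul_eq_mul, mul_ite, mul_one,
    mul_zero]
  rw [Finset.sum_ite_eq']
  split_ifs with hn
  · rfl
  · exact (Finsupp.notMem_support_iff.1 hn).symm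

lemma eq_of_hall_macQ (h : Generic q t) {f g : SymFun K}
    (hfg : ∀ nu, hall q t f (macQ q t nu) = hall q t g (macQ q t nu)) : f = g := by
  refine (macP_isMacdonaldFamily h).eq_of_hall h fun nu => ?_
  have := hfg nu
  rw [macQ, map_smul, map_smul] at this
  exact smul_right_injective K (macB_ne_zero h nu) this

/-- The finite sum satisfies the condition defining `skewP`, so the chosen element satisfies it too.
Nondegeneracy makes the two equal. -/
lemma skewP_eq (h : Generic q t) (lam mu : YoungDiagram) :
    skewP q t lam mu = (skewCoeff q t lam mu).sum fun nu c => c • macP q t nu := by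
  have h1 : ∃ f : SymFun K, ∀ nu : YoungDiagram,
      hall q t f (macQ q t nu) = hall q t (macP q t lam) (macQ q t mu * macQ q t nu) :=
    ⟨(skewCoeff q t lam mu).sum fun nu c => c • macP q t nu, fun nu => by
      rw [hall_sum_macP h, skewCoeff_apply h]⟩
  have h2 := Classical.epsilon_spec h1
  refine eq_of_hall_macQ h fun nu => ?_
  rw [hall_sum_macP h, skewCoeff_apply h]
  exact h2 nu

end Vanishing

/-! ### The field of rational functions -/

lemma algebraMap_QT_injective : Function.Injective (algebraMap (MvPolynomial (Fin 2) ℚ) QT) :=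
  IsFractionRing.injective _ _

lemma one_sub_X_pow_ne_zero (i : Fin 2) (k : ℕ) :
    (1 - MvPolynomial.X i ^ (k + 1) : MvPolynomial (Fin 2) ℚ) ≠ 0 := by
  intro h
  have := congrArg (MvPolynomial.eval fun _ => (0 : ℚ)) h
  simp at this

lemma generic_qvar_tvar : Generic qvar tvar where
  q_pow k := by
    have := (map_ne_zero_iff _ algebraMap_QT_injective).2 (one_sub_X_pow_ne_zero 0 k)
    simpa [qvar] using this
  t_pow k := by
    have := (map_ne_zero_iff _ algebraMap_QT_injective).2 (one_sub_X_pow_ne_zero 1 k)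
    simpa [tvar] using this
  t_ne := (map_ne_zero_iff _ algebraMap_QT_injective).2 (MvPolynomial.X_ne_zero 1)
  -- Multiplying by t^N, with N at least every row index, clears denominators and turns distinct
  -- boxes (i, j) into distinct monomials q^j t^(N-i).
  cells S T hST := by
    classical
    have ht : tvar ≠ 0 := (map_ne_zero_iff _ algebraMap_QT_injective).2 (MvPolynomial.X_ne_zero 1)
    obtain ⟨N, hN⟩ : ∃ N, ∀ x ∈ S ∪ T, x.1 ≤ N :=
      ⟨(S ∪ T).sup Prod.fst, fun x hx => Finset.le_sup (f := Prod.fst) hx⟩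
    let d : ℕ × ℕ → (Fin 2 →₀ ℕ) := fun x => Finsupp.single 0 x.2 + Finsupp.single 1 (N - x.1)
    have hd : Set.InjOn d (S ∪ T : Finset (ℕ × ℕ)) := by
      intro x hx y hy hxy
      have h0 := DFunLike.congr_fun hxy 0
      have h1 := DFunLike.congr_fun hxy 1
      have hx := hN x hx
      have hy := hN y hy
      simp [d] at h0 h1
      exact Prod.ext (by omega) h0
    have key : ∀ U ⊆ S ∪ T, tvar ^ N * ∑ x ∈ U, qvar ^ x.2 * tvar⁻¹ ^ x.1 =
        algebraMap (MvPolynomial (Fin 2) ℚ) QT (∑ x ∈ U, MvPolynomial.monomial (d x) 1) := by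
      intro U hU
      rw [Finset.mul_sum, map_sum]
      refine Finset.sum_congr rfl fun x hx => ?_
      have h1 : MvPolynomial.monomial (d x) (1 : ℚ) =
          MvPolynomial.X 0 ^ x.2 * MvPolynomial.X 1 ^ (N - x.1) := by
        rw [MvPolynomial.X_pow_eq_monomial, MvPolynomial.X_pow_eq_monomial,
          MvPolynomial.monomial_mul, one_mul]
      rw [h1, map_mul, map_pow, map_pow]
      change _ = qvar ^ x.2 * tvar ^ (N - x.1)
      rw [pow_sub₀ _ ht (hN x (hU hx)), inv_pow]
      ring
    have h1 := congrArg (tvar ^ N * ·) hST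
    rw [key S Finset.subset_union_left, key T Finset.subset_union_right] at h1
    have h2 := algebraMap_QT_injective h1
    have h3 : ∀ U ⊆ S ∪ T, ∀ x ∈ S ∪ T, MvPolynomial.coeff (d x)
        (∑ y ∈ U, MvPolynomial.monomial (d y) (1 : ℚ)) = if x ∈ U then 1 else 0 := by
      intro U hU x hx
      rw [MvPolynomial.coeff_sum, ← Finset.sum_ite_eq' U x fun _ => (1 : ℚ)]
      refine Finset.sum_congr rfl fun y hy => ?_
      rw [MvPolynomial.coeff_monomial]
      exact if_congr ⟨fun h => hd (hU hy) hx h, fun h => by rw [h]⟩ rfl rfl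
    ext x
    by_cases hx : x ∈ S ∪ T
    · have h4 := h3 S Finset.subset_union_left x hx
      rw [h2, h3 T Finset.subset_union_right x hx] at h4
      by_cases hS : x ∈ S <;> by_cases hT : x ∈ T <;> simp [hS, hT] at h4 ⊢
    · rw [Finset.mem_union, not_or] at hx
      simp [hx.1, hx.2]

end Macdonald

end

theorem proposition6p5 (lam mu : YoungDiagram) (hsub : mu ≤ lam)
    (hlen : mu.colLen 0 < lam.colLen 0) :
    (∃ r : YoungDiagram →₀ Macdonald.QT,
      (∀ r' : YoungDiagram →₀ Macdonald.QT,
        Macdonald.skewP Macdonald.qvar Macdonald.tvar lam mu =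
          (r'.sum fun nu c => c • Macdonald.macP Macdonald.qvar Macdonald.tvar nu) ↔ r' = r) ∧
      (∀ nu : YoungDiagram, r nu ≠ 0 →
        mu.card + nu.card = lam.card ∧ lam.rowLen (mu.colLen 0) ≤ nu.rowLen 0) ∧
      (∀ nu : YoungDiagram, r nu = 0 ↔
        Macdonald.lrCoeff Macdonald.qvar Macdonald.tvar lam mu nu = 0)) ∧
    (∀ nu : YoungDiagram, nu.rowLen 0 < lam.rowLen (mu.colLen 0) →
      Macdonald.lrCoeff Macdonald.qvar Macdonald.tvar lam mu nu = 0) := by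
  have h := Macdonald.generic_qvar_tvar
  have hP := Macdonald.macP_isMacdonaldFamily h
  have hvan : ∀ nu : YoungDiagram, nu.rowLen 0 < lam.rowLen (mu.colLen 0) →
      Macdonald.lrCoeff Macdonald.qvar Macdonald.tvar lam mu nu = 0 := fun nu hnu => by
    rw [Macdonald.lrCoeff_eq, hP.hall_mul_eq_zero h hnu, mul_zero]
  -- Both quantities are ⟨P_lam, P_mu P_nu⟩ times nonzero factors: b_mu b_nu for the skew
  -- coefficient, b_lam for the Littlewood–Richardson coefficient.
  have hiff : ∀ nu : YoungDiagram,
      Macdonald.skewCoeff Macdonald.qvar Macdonald.tvar lam mu nu = 0 ↔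
        Macdonald.lrCoeff Macdonald.qvar Macdonald.tvar lam mu nu = 0 := by
    intro nu
    rw [Macdonald.skewCoeff_apply h, Macdonald.hall_macQ_mul_macQ, Macdonald.lrCoeff_eq,
      mul_eq_zero_iff_left (mul_ne_zero (Macdonald.macB_ne_zero h mu)
        (Macdonald.macB_ne_zero h nu)), mul_eq_zero_iff_left (Macdonald.macB_ne_zero h lam)]
  refine ⟨⟨Macdonald.skewCoeff Macdonald.qvar Macdonald.tvar lam mu, fun r' => ?_, fun nu hnu => ?_,
    hiff⟩, hvan⟩
  · rw [Macdonald.skewP_eq h]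
    refine ⟨fun hr => ?_, fun hr => by rw [hr]⟩
    ext nu
    -- Pairing with Q_nu reads off the coefficient at nu, which gives uniqueness.
    rw [← Macdonald.hall_sum_macP h r' nu, ← hr, Macdonald.hall_sum_macP h]
  · constructor
    · by_contra hc
      refine hnu ((hiff nu).2 ?_)
      rw [Macdonald.lrCoeff_eq, Macdonald.hall_macP_mul_macP_of_card_ne h hc, mul_zero]
    · by_contra hlt
      exact hnu ((hiff nu).2 (hvan nu (not_le.1 hlt)))
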